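/- Let $P\ge 0$, $n\ge 1$, and let $\mathcal M=(\mathbb S^{n-1})^P\subset(\mathbb R^n)^P$ with the product of the round metrics. Write $y=(y_{(1)},\dots,y_{(P)})$ for its points and $\nabla_{(k)}$ for the Euclidean gradient in the $k$-th block of $(\mathbb R^n)^P$. Let $q$ be a Borel probability measure on $\mathcal M$, let $p:\mathcal M\to(0,\infty)$ be smooth (the target density), and let $K(y,y')=\prod_{k=1}^P K_{(k)}(y_{(k)},y'_{(k)})$ be a positive semidefinite kernel on $\mathcal M$ with smooth factors $K_{(k)}:\mathbb S^{n-1}\times\mathbb S^{n-1}\to(0,\infty)$. Let $\mathcal H_K$ be the reproducing kernel Hilbert space of $K$, and let $\mathfrak X=\{\mathrm{grad}\,f : f\in\mathcal H_K\}$ with the norm $\|X\|_{\mathfrak X}=\inf\{\|f\|_{\mathcal H_K} : f\in\mathcal H_K,\ \mathrm{grad}\,f=X\}$ (which is $\|f\|_{\mathcal H_K}$ for the unique $f$ with $\mathrm{grad}\,f=X$ if $0$ is the only $f\in\mathcal H_K$ with $\mathrm{grad}\,f=0$). For $X\in\mathfrak X$ put $\mathcal J(X)=\mathbb E_q\big[X[\log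 p]+\mathrm{div}(X)\big]$. A vector field $X^*\in\mathfrak X$ is called the functional gradient if $X^*=\mathcal J(X^o)X^o$ for every maximizer $X^o$ of $\mathcal J$ over $\{X\in\mathfrak X:\|X\|_{\mathfrak X}=1\}$, and such a maximizer exists whenever this set is non-empty. Let $$\hat f(y')=\mathbb E_{q(y)}\Big[\big(\mathrm{grad}\,K(\cdot,y')\big)[\log p](y)+\Delta K(\cdot,y')(y)\Big],\qquad \hat X=\mathrm{grad}\,\hat f,$$ where $\mathrm{grad}$, $\mathrm{div}$ and $\Delta=\mathrm{div}\,\mathrm{grad}$ are the Riemannian operators of $\mathcal M$. Take any extensions of $p$ and of the $K_{(k)}$ to functions on $(\mathbb R^n)^P$ and on $\mathbb R^n\times\mathbb R^n$ that are smooth at the points of $\mathcal M$ and of $\mathbb S^{n-1}\times\mathbb S^{n-1}$. For $y'$ in $(\mathbb R^n)^P$, set $$\begin{aligned}\hat F(y')=\mathbb E_{q(y)}\Big[K\sum_{k=1}^{P}\Big[&(\nabla_{(k)}\log p)^\top\nabla_{(k)}\log K_{(k)}+\nabla_{(k)}^\top\nabla_{(k)}\log K_{(k)}-y_{(k)}^\top\big(\nabla_{(k)}\nabla_{(k)}^\top\log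 K_{(k)}\big)y_{(k)}\\&+\big\|\nabla_{(k)}\log K_{(k)}\big\|^2-\big(y_{(k)}^\top\nabla_{(k)}\log K_{(k)}\big)^2\\&-\big(y_{(k)}^\top\nabla_{(k)}\log p+n-1\big)\,y_{(k)}^\top\nabla_{(k)}\log K_{(k)}\Big]\Big],\end{aligned}$$ where $K=\prod_k K_{(k)}$ and $K_{(k)}$ are taken at $(y,y')$ and $(y_{(k)},y'_{(k)})$, and all derivatives are with respect to $y$. Then $\hat X$ is the functional gradient. For every $y'\in\mathcal M$, the expectations defining $\hat f(y')$ and $\hat F(y')$ exist and $\hat f(y')=\hat F(y')$; moreover $\hat F$ is differentiable at $y'$, and for $\ell=1,\dots,P$ $$\hat X_{(\ell)}(y')=\big(I_n-y'_{(\ell)}{y'_{(\ell)}}^\top\big)\nabla'_{(\ell)}\hat F(y').$$ -/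

import Mathlib

open MeasureTheory
open scoped ContDiff Gradient

noncomputable section

namespace SphereProduct

/-- The factor `𝕊^{n-1}`, with `n = d + 1`, as the unit sphere of `ℝⁿ`. -/
abbrev Sph (d : ℕ) : Type :=
  Metric.sphere (0 : EuclideanSpace ℝ (Fin (d + 1))) 1

/-- The product manifold `(𝕊^{n-1})^P`, with `n = d + 1`. -/
abbrev SphProd (P d : ℕ) : Type := Fin P → Sph d

/-- The embedding space `(ℝⁿ)^P` with its Euclidean inner product; the `ℓ`-th block of `v` is
`v ℓ`. -/
abbrev Amb (P d : ℕ) : Type :=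
  PiLp 2 fun _ : Fin P => EuclideanSpace ℝ (Fin (d + 1))

/-- The coordinate indices `(k, i)`. -/
abbrev Idx (P d : ℕ) : Type := Fin P × Fin d

variable {P d : ℕ}

/-- The isometric embedding `Ξ : (𝕊^{n-1})^P → (ℝⁿ)^P`. -/
def embed (A : SphProd P d) : Amb P d :=
  WithLp.toLp 2 fun k => (A k : EuclideanSpace ℝ (Fin (d + 1)))

/-! ### The product coordinate system around a point

In each factor it is the chart of the smooth manifold structure that Mathlib puts on the sphere;
its inverse is defined on all of the coordinate space. -/

/-- The coordinates of `B` in the product coordinate system around `A`. -/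
def coord (A B : SphProd P d) : Idx P d → ℝ :=
  fun i => chartAt (EuclideanSpace ℝ (Fin d)) (A i.1) (B i.1) i.2

/-- The point with coordinates `x` in the product coordinate system around `A`. -/
def coordInv (A : SphProd P d) (x : Idx P d → ℝ) : SphProd P d :=
  fun k => (chartAt (EuclideanSpace ℝ (Fin d)) (A k)).symm (WithLp.toLp 2 fun i => x (k, i))

/-- The partial derivative `∂φ/∂xⁱ`. -/
def partialDeriv {W : Type*} [NormedAddCommGroup W] [NormedSpace ℝ W]
    (φ : (Idx P d → ℝ) → W) (i : Idx P d) (x : Idx P d → ℝ) : W :=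
  fderiv ℝ φ x (Pi.single i 1)

/-- The natural basis vector `∂ᵢ` at the point with coordinates `x`, as a vector of the embedding
space. -/
def basisVec (A : SphProd P d) (x : Idx P d → ℝ) (i : Idx P d) : Amb P d :=
  partialDeriv (fun x => embed (coordInv A x)) i x

/-- The Riemann metric tensor `G = (gᵢⱼ)`, `gᵢⱼ = g(∂ᵢ, ∂ⱼ)`, in the coordinate system around
`A`. -/
def metricTensor (A : SphProd P d) (x : Idx P d → ℝ) : Matrix (Idx P d) (Idx P d) ℝ :=
  Matrix.of fun i j => inner ℝ (basisVec A x i) (basisVec A x j)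

/-- The component `Xⁱ = gⁱʲ g(∂ⱼ, X)` of a vector field in the coordinate system around `A`.
Tangent vectors are regarded as vectors of the embedding space. -/
def component (A : SphProd P d) (X : SphProd P d → Amb P d) (i : Idx P d) (x : Idx P d → ℝ) : ℝ :=
  ∑ j, (metricTensor A x)⁻¹ i j * inner ℝ (basisVec A x j) (X (coordInv A x))

/-- `grad f = gⁱʲ ∂ᵢf ∂ⱼ`. -/
def grad (f : SphProd P d → ℝ) (A : SphProd P d) : Amb P d :=
  ∑ j, (∑ i, (metricTensor A (coord A A))⁻¹ i j *
    partialDeriv (fun x => f (coordInv A x)) i (coord A A)) • basisVec A (coord A A) j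

/-- The action `X[f] = Xⁱ ∂ᵢf` of a vector field on a function. -/
def act (X : SphProd P d → Amb P d) (f : SphProd P d → ℝ) (A : SphProd P d) : ℝ :=
  ∑ i, component A X i (coord A A) * partialDeriv (fun x => f (coordInv A x)) i (coord A A)

/-- The divergence `div X = ∂ᵢ(√|G| Xⁱ) / √|G|`. -/
def div (X : SphProd P d → Amb P d) (A : SphProd P d) : ℝ :=
  (∑ i, partialDeriv (fun x => √(metricTensor A x).det * component A X i x) i (coord A A)) /
    √(metricTensor A (coord A A)).det

/-- The Beltrami-Laplace operator `Δ f = div (grad f)`. -/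
def beltrami (f : SphProd P d → ℝ) : SphProd P d → ℝ := div (grad f)

/-! ### The functional gradient -/

/-- The objective `𝒥(X) = 𝔼_q [X[log p] + div X]`. -/
def objective (q : Measure (SphProd P d)) (p : SphProd P d → ℝ) (X : SphProd P d → Amb P d) : ℝ :=
  ∫ A, act X (fun B => Real.log (p B)) A + div X A ∂q

/-- The space `𝔛 = {grad f | f ∈ H}` of vector fields, for a space `H` of functions. -/
def gradFields (H : Type*) [FunLike H (SphProd P d) ℝ] : Set (SphProd P d → Amb P d) :=
  {X | ∃ f : H, X = grad f}

/-- The norm that `𝔛` inherits from `H` through `f ↦ grad f`. If zero is the only function in `H`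
with vanishing gradient, then this is `‖f‖` for the unique `f` with `X = grad f`; in general it is
the quotient norm. -/
def gradNorm (H : Type*) [FunLike H (SphProd P d) ℝ] [Norm H] (X : SphProd P d → Amb P d) : ℝ :=
  sInf {r | ∃ f : H, X = grad f ∧ r = ‖f‖}

/-- `X₀` maximizes `𝒥` on the unit sphere of `𝔛`. -/
def IsMaximizer (H : Type*) [FunLike H (SphProd P d) ℝ] [Norm H]
    (q : Measure (SphProd P d)) (p : SphProd P d → ℝ) (X₀ : SphProd P d → Amb P d) : Prop :=
  X₀ ∈ gradFields H ∧ gradNorm H X₀ = 1 ∧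
    ∀ X ∈ gradFields H, gradNorm H X = 1 → objective q p X ≤ objective q p X₀

/-- `Y` is the functional gradient: it lies in `𝔛`, and it is `𝒥(X₀) X₀` for the maximizer `X₀` of
`𝒥` on the unit sphere of `𝔛`. A maximizer exists as soon as `𝔛` has a unit vector. -/
def IsFunctionalGradient (H : Type*) [FunLike H (SphProd P d) ℝ] [Norm H]
    (q : Measure (SphProd P d)) (p : SphProd P d → ℝ) (Y : SphProd P d → Amb P d) : Prop :=
  Y ∈ gradFields H ∧
    ((∃ X ∈ gradFields H, gradNorm H X = 1) → ∃ X₀, IsMaximizer H q p X₀) ∧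
    ∀ X₀, IsMaximizer H q p X₀ → Y = objective q p X₀ • X₀

/-- The product kernel `K(y, y') = ∏ₖ K₍ₖ₎(y₍ₖ₎, y'₍ₖ₎)`. -/
def prodKernel (κ : Fin P → Sph d → Sph d → ℝ) (A B : SphProd P d) : ℝ :=
  ∏ k, κ k (A k) (B k)

/-- The integrand `(grad K(·, B))[log p](A) + Δ K(·, B)(A)`, with `grad` and `Δ` taken in the
variable `A`. -/
def fhatIntegrand (p : SphProd P d → ℝ) (K : SphProd P d → SphProd P d → ℝ) (B A : SphProd P d) : ℝ :=
  act (grad fun C => K C B) (fun C => Real.log (p C)) A + beltrami (fun C => K C B) A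

/-- `f̂(B) = 𝔼_{q(A)} [(grad K(A, B))[log p(A)] + Δ K(A, B)]`. -/
def fhat (q : Measure (SphProd P d)) (p : SphProd P d → ℝ) (K : SphProd P d → SphProd P d → ℝ)
    (B : SphProd P d) : ℝ :=
  ∫ A, fhatIntegrand p K B A ∂q

/-- `X̂ = grad f̂`. -/
def Xhat (q : Measure (SphProd P d)) (p : SphProd P d → ℝ) (K : SphProd P d → SphProd P d → ℝ) :
    SphProd P d → Amb P d :=
  grad (fhat q p K)

/-! ### The expression in the embedding space -/

/-- The quadratic form `yᵀ (∇∇ᵀ f) y` of the Hessian of `f` at `y`. -/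
def hessQuad (f : EuclideanSpace ℝ (Fin (d + 1)) → ℝ) (y : EuclideanSpace ℝ (Fin (d + 1))) : ℝ :=
  inner ℝ y (fderiv ℝ (∇ f) y y)

/-- The `k`-th summand of the embedded expression at `y ∈ 𝕊^{n-1}`, where `a` stands for
`∇₍ₖ₎ log p` and `L` for `log K₍ₖ₎(·, y'₍ₖ₎)`. Note `n - 1 = d`. -/
def embSummand (a : EuclideanSpace ℝ (Fin (d + 1))) (L : EuclideanSpace ℝ (Fin (d + 1)) → ℝ)
    (y : EuclideanSpace ℝ (Fin (d + 1))) : ℝ :=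
  inner ℝ a (∇ L y) + Laplacian.laplacian L y - hessQuad L y
    + ‖∇ L y‖ ^ 2 - (inner ℝ y (∇ L y)) ^ 2
    - (inner ℝ y a + (((d + 1 : ℕ) : ℝ) - 1)) * inner ℝ y (∇ L y)

/-- The integrand of the embedded expression, for functions `pe` on `(ℝⁿ)^P` and `κe k` on
`ℝⁿ × ℝⁿ`, at `y = A` and `y' = z`. -/
def embIntegrand (pe : Amb P d → ℝ)
    (κe : Fin P → EuclideanSpace ℝ (Fin (d + 1)) → EuclideanSpace ℝ (Fin (d + 1)) → ℝ)
    (z : Amb P d) (A : SphProd P d) : ℝ :=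
  (∏ k, κe k (A k) (z k)) *
    ∑ k, embSummand ((∇ (fun w => Real.log (pe w)) (embed A)) k)
      (fun y => Real.log (κe k y (z k))) (A k)

/-- The embedded expression of `f̂`, a function of `y' = z` in the embedding space. -/
def embFhat (q : Measure (SphProd P d)) (pe : Amb P d → ℝ)
    (κe : Fin P → EuclideanSpace ℝ (Fin (d + 1)) → EuclideanSpace ℝ (Fin (d + 1)) → ℝ)
    (z : Amb P d) : ℝ :=
  ∫ A, embIntegrand pe κe z A ∂q

/-- `(I - y yᵀ) v`. -/
def tangentProj (y v : EuclideanSpace ℝ (Fin (d + 1))) : EuclideanSpace ℝ (Fin (d + 1)) :=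
  WithLp.toLp 2 ((1 - Matrix.vecMulVec y.ofLp y.ofLp).mulVec v.ofLp)

end SphereProduct

end

open SphereProduct

noncomputable section

namespace SphereProduct

set_option maxSynthPendingDepth 3

variable {P d : ℕ}

/-! The operator `f ↦ (grad f)[log p] + Δ f` is linear, and the reproducing property moves it onto
the feature map: `f(A) = ⟨f, Φ(A)⟩`. Because the kernel is smooth, `Φ`, extended by radial
retraction to an open subset of the embedding space, is smooth as a Hilbert-space-valued map
(`contDiffOn_of_contDiffOn_kernel`). The operator at `A` is therefore pairing with a vector `ψ(A) ∈
H` (`generator_eq_inner`) that depends continuously on `A`. By compactness `ψ` is Bochner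
integrable; with `g = ∫ ψ dq`, `𝒥(grad f) = ⟨f, g⟩`, and testing against kernel sections gives `f̂ =
g`.

The maximization is then Cauchy–Schwarz. The norm on `𝔛` is the quotient norm modulo the closed
kernel `N` of `grad`, and `g ⟂ N` because `𝒥` sees only `grad f`. Hence for `g ≠ 0` the unique
maximizer is `grad (g / ‖g‖)`, with value `‖g‖`, and the product is `grad g`; for `g = 0` both sides
vanish (`isFunctionalGradient_of_inner`).

For the explicit formula, stereographic coordinates centred at `A` are conformal with density
stationary at the centre. There `Δ` is the Euclidean trace of the Hessian of any extension, minus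
its normal part, minus `d` times the normal derivative in each block (`generator_eq`). Writing `K =
exp (∑ log K₍ₖ₎)` near the manifold gives the embedded integrand (`generator_exp_sum`). Finally `F̂`
is differentiable by dominated convergence and extends `f̂`, so `grad f̂` is the tangential part of
its Euclidean gradient. -/

lemma finrank_euclideanSpace_succ (d : ℕ) :
    Fact (Module.finrank ℝ (EuclideanSpace ℝ (Fin (d + 1))) = d + 1) :=
  ⟨by simp⟩

attribute [local instance] finrank_euclideanSpace_succ

abbrev innerProductSpaceAmb : InnerProductSpace ℝ (Amb P d) := PiLp.innerProductSpace _

attribute [local instance] innerProductSpaceAmb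

abbrev normedSpaceAmb : NormedSpace ℝ (Amb P d) := InnerProductSpace.toNormedSpace

attribute [local instance] normedSpaceAmb

abbrev moduleAmb : Module ℝ (Amb P d) := NormedSpace.toModule

attribute [local instance] moduleAmb

abbrev smulAmb : SMul ℝ (Amb P d) := Module.toDistribMulAction.toSMul

attribute [local instance] smulAmb

lemma continuousSMulAmb : ContinuousSMul ℝ (Amb P d) := IsBoundedSMul.continuousSMul

attribute [local instance] continuousSMulAmb

/-! ### Stereographic coordinates on one sphere. -/

/-- The isometry of the coordinate space onto the tangent space of the sphere at `a` that underlies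
the stereographic chart at `a`. -/
def frame (a : Sph d) :
    EuclideanSpace ℝ (Fin d) →ₗᵢ[ℝ] EuclideanSpace ℝ (Fin (d + 1)) :=
  (Submodule.orthogonal
    (Submodule.span ℝ {((-a : Sph d) : EuclideanSpace ℝ (Fin (d + 1)))})).subtypeₗᵢ.comp
    (OrthonormalBasis.fromOrthogonalSpanSingleton d
      (ne_zero_of_mem_unit_sphere (-a))).repr.symm.toLinearIsometry

/-- The inverse of the stereographic chart at `a`, as a map into the embedding space. -/
def stereo (a : Sph d) (w : EuclideanSpace ℝ (Fin d)) : EuclideanSpace ℝ (Fin (d + 1)) :=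
  (4 / (‖w‖ ^ 2 + 4)) • (frame a w + (2 : ℝ) • (a : EuclideanSpace ℝ (Fin (d + 1)))) - a

/-- The derivative of `stereo`. -/
def stereoDeriv (a : Sph d) (w : EuclideanSpace ℝ (Fin d)) :
    EuclideanSpace ℝ (Fin d) →L[ℝ] EuclideanSpace ℝ (Fin (d + 1)) :=
  (4 / (‖w‖ ^ 2 + 4)) • (frame a).toContinuousLinearMap -
    (8 / (‖w‖ ^ 2 + 4) ^ 2) • (innerSL ℝ w).smulRight
      (frame a w + (2 : ℝ) • (a : EuclideanSpace ℝ (Fin (d + 1))))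

lemma inner_frame_right (a : Sph d) (w : EuclideanSpace ℝ (Fin d)) :
    inner ℝ (a : EuclideanSpace ℝ (Fin (d + 1))) (frame a w) = 0 := by
  have h := ((OrthonormalBasis.fromOrthogonalSpanSingleton d
      (ne_zero_of_mem_unit_sphere (-a))).repr.symm w).2
  rw [Submodule.mem_orthogonal_singleton_iff_inner_right] at h
  have h' : -inner ℝ (a : EuclideanSpace ℝ (Fin (d + 1))) (frame a w) = 0 := by
    rw [← inner_neg_left]
    exact h
  exact neg_eq_zero.mp h'

lemma inner_frame_left (a : Sph d) (w : EuclideanSpace ℝ (Fin d)) :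
    inner ℝ (frame a w) (a : EuclideanSpace ℝ (Fin (d + 1))) = 0 := by
  rw [real_inner_comm, inner_frame_right]

lemma inner_self_sph (a : Sph d) :
    inner ℝ (a : EuclideanSpace ℝ (Fin (d + 1))) (a : EuclideanSpace ℝ (Fin (d + 1))) = 1 := by
  simp

/-- The chart at `a` projects from `-a`. Collecting the coefficients of `a` puts the inverse in a
form whose only nonlinearity is the factor `4 / (‖w‖² + 4)`. -/
lemma chartAt_symm_apply (a : Sph d) (w : EuclideanSpace ℝ (Fin d)) :
    (((chartAt (EuclideanSpace ℝ (Fin d)) a).symm w : Sph d) :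
      EuclideanSpace ℝ (Fin (d + 1))) = stereo a w := by
  have h := stereographic'_symm_apply (n := d) (-a) w
  have hn : ‖((OrthonormalBasis.fromOrthogonalSpanSingleton (𝕜 := ℝ) d
      (ne_zero_of_mem_unit_sphere (-a))).repr.symm w : EuclideanSpace ℝ (Fin (d + 1)))‖ = ‖w‖ := by
    rw [Submodule.norm_coe, LinearIsometryEquiv.norm_map]
  have h2 : (((chartAt (EuclideanSpace ℝ (Fin d)) a).symm w : Sph d) :
      EuclideanSpace ℝ (Fin (d + 1))) =
      (‖w‖ ^ 2 + 4)⁻¹ • (4 : ℝ) • frame a w + (‖w‖ ^ 2 + 4)⁻¹ • (‖w‖ ^ 2 - 4) •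
        (-a : EuclideanSpace ℝ (Fin (d + 1))) := by
    simp only [hn] at h
    exact h
  rw [h2, stereo]
  have : ‖w‖ ^ 2 + 4 ≠ 0 := by positivity
  match_scalars
  · field_simp
  · field_simp
    ring

lemma chartAt_self (a : Sph d) : chartAt (EuclideanSpace ℝ (Fin d)) a a = 0 := by
  change stereographic' d (-a) a = 0
  change (OrthonormalBasis.fromOrthogonalSpanSingleton d (ne_zero_of_mem_unit_sphere (-a))).repr
    (stereographic (norm_eq_of_mem_sphere (-a)) a) = 0
  rw [stereographic_neg_apply, map_zero]

lemma stereo_zero (a : Sph d) : stereo a 0 = a := by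
  simp only [stereo, norm_zero, map_zero]
  match_scalars
  norm_num

lemma coord_self (A : SphProd P d) : coord A A = 0 := by
  funext i
  simp [coord, chartAt_self]

lemma coordInv_coe (A : SphProd P d) (x : Idx P d → ℝ) (k : Fin P) :
    (coordInv A x k : EuclideanSpace ℝ (Fin (d + 1))) =
      stereo (A k) (WithLp.toLp 2 fun i => x (k, i)) :=
  chartAt_symm_apply _ _

lemma coordInv_zero (A : SphProd P d) : coordInv A 0 = A := by
  funext k
  apply Subtype.ext
  rw [coordInv_coe]
  exact stereo_zero _

lemma hasFDerivAt_stereo (a : Sph d) (w : EuclideanSpace ℝ (Fin d)) :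
    HasFDerivAt (stereo a) (stereoDeriv a w) w := by
  have hs : ‖w‖ ^ 2 + 4 ≠ 0 := by positivity
  have h1 : HasFDerivAt (fun w : EuclideanSpace ℝ (Fin d) => ‖w‖ ^ 2 + 4) (2 • innerSL ℝ w) w :=
    (hasStrictFDerivAt_norm_sq w).hasFDerivAt.add_const 4
  have h2 := (((hasFDerivAt_inv hs).comp w h1).const_mul 4).smul
    (((frame a).toContinuousLinearMap.hasFDerivAt (x := w)).add_const
      ((2 : ℝ) • (a : EuclideanSpace ℝ (Fin (d + 1)))))
  have h3 : stereo a = fun w => (4 * (‖w‖ ^ 2 + 4)⁻¹) •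
      (frame a w + (2 : ℝ) • (a : EuclideanSpace ℝ (Fin (d + 1)))) - a := by
    funext w
    simp [stereo, div_eq_mul_inv]
  rw [h3]
  refine (h2.sub_const (a : EuclideanSpace ℝ (Fin (d + 1)))).congr_fderiv ?_
  ext1 u
  simp [stereoDeriv]
  match_scalars <;> field_simp <;> ring

/-- Stereographic projection is conformal; the factor equals `1` at the centre `w = 0`. -/
lemma inner_stereoDeriv (a : Sph d) (w u v : EuclideanSpace ℝ (Fin d)) :
    inner ℝ (stereoDeriv a w u) (stereoDeriv a w v) =
      (4 / (‖w‖ ^ 2 + 4)) ^ 2 * inner ℝ u v := by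
  have hs : ‖w‖ ^ 2 + 4 ≠ 0 := by positivity
  have hw : inner ℝ w w = ‖w‖ ^ 2 := real_inner_self_eq_norm_sq w
  simp only [stereoDeriv, sub_apply, smul_apply,
    ContinuousLinearMap.smulRight_apply, innerSL_apply_apply, LinearIsometry.coe_toContinuousLinearMap,
    inner_sub_left, inner_sub_right, inner_smul_left, inner_smul_right, inner_add_left,
    inner_add_right, LinearIsometry.inner_map_map, inner_frame_left, inner_frame_right,
    inner_self_sph, hw, real_inner_comm w u]
  simp
  field_simp
  ring

lemma inner_stereoDeriv_stereo (a : Sph d) (w u : EuclideanSpace ℝ (Fin d)) :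
    inner ℝ (stereoDeriv a w u) (stereo a w) = 0 := by
  have hs : ‖w‖ ^ 2 + 4 ≠ 0 := by positivity
  have hw : inner ℝ w w = ‖w‖ ^ 2 := real_inner_self_eq_norm_sq w
  simp only [stereo, stereoDeriv, sub_apply, smul_apply,
    ContinuousLinearMap.smulRight_apply, innerSL_apply_apply, LinearIsometry.coe_toContinuousLinearMap,
    inner_sub_left, inner_sub_right, inner_smul_left, inner_smul_right, inner_add_left,
    inner_add_right, LinearIsometry.inner_map_map, inner_frame_left, inner_frame_right,
    inner_self_sph, hw, real_inner_comm w u]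
  simp
  field_simp
  ring

lemma stereoDeriv_zero (a : Sph d) (u : EuclideanSpace ℝ (Fin d)) :
    stereoDeriv a 0 u = frame a u := by
  simp only [stereoDeriv, sub_apply, smul_apply, ContinuousLinearMap.smulRight_apply,
    innerSL_apply_apply, LinearIsometry.coe_toContinuousLinearMap, inner_zero_left, norm_zero]
  norm_num

/-! ### Product coordinates and the metric tensor. -/

/-- The `k`-th block of a coordinate vector. -/
def blockCoord (k : Fin P) : (Idx P d → ℝ) →L[ℝ] EuclideanSpace ℝ (Fin d) :=
  ((PiLp.continuousLinearEquiv 2 ℝ fun _ : Fin d => ℝ).symm : (Fin d → ℝ) →L[ℝ] _) ∘L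
    ContinuousLinearMap.pi fun i => ContinuousLinearMap.proj (k, i)

/-- The inclusion of the `k`-th block into the embedding space. -/
def incl (k : Fin P) : EuclideanSpace ℝ (Fin (d + 1)) →L[ℝ] Amb P d :=
  ((PiLp.continuousLinearEquiv 2 ℝ fun _ : Fin P => EuclideanSpace ℝ (Fin (d + 1))).symm :
    (Fin P → EuclideanSpace ℝ (Fin (d + 1))) →L[ℝ] _) ∘L
    ContinuousLinearMap.single ℝ (fun _ : Fin P => EuclideanSpace ℝ (Fin (d + 1))) k

lemma incl_apply (k m : Fin P) (v : EuclideanSpace ℝ (Fin (d + 1))) :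
    incl k v m = if m = k then v else 0 := by
  change (Pi.single k v : Fin P → EuclideanSpace ℝ (Fin (d + 1))) m = _
  rw [Pi.single_apply]

lemma inner_incl_left (k : Fin P) (u : EuclideanSpace ℝ (Fin (d + 1))) (v : Amb P d) :
    inner ℝ (incl k u) v = inner ℝ u (v k) := by
  rw [PiLp.inner_apply, Finset.sum_eq_single k]
  · simp [incl_apply]
  · intro m _ hm
    simp [incl_apply, hm]
  · simp

lemma inner_incl_right (k : Fin P) (u : EuclideanSpace ℝ (Fin (d + 1))) (v : Amb P d) :
    inner ℝ v (incl k u) = inner ℝ (v k) u := by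
  rw [real_inner_comm, inner_incl_left, real_inner_comm]

lemma sum_incl (v : Amb P d) : ∑ k, incl k (v k) = v := by
  ext m : 1
  rw [WithLp.ofLp_sum, Finset.sum_apply, Finset.sum_eq_single m]
  · simp [incl_apply]
  · intro k _ hk
    simp [incl_apply, hk.symm]
  · simp

lemma blockCoord_apply (k : Fin P) (x : Idx P d → ℝ) :
    blockCoord k x = WithLp.toLp 2 fun i => x (k, i) := rfl

lemma blockCoord_single (k : Fin P) (j : Idx P d) :
    blockCoord k (Pi.single j 1) = if k = j.1 then EuclideanSpace.single j.2 (1 : ℝ) else 0 := by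
  ext i
  rw [blockCoord_apply]
  by_cases h : k = j.1
  · by_cases h' : i = j.2
    · simp only [h, h']
      simp
    · simp [h, h', Pi.single_apply]
      intro e
      exact absurd (by rw [← e]) h'
  · have : (k, i) ≠ j := fun e => h (by rw [← e])
    simp [h, this]

/-- The derivative of the parametrisation of the product of spheres. -/
def paramDeriv (A : SphProd P d) (x : Idx P d → ℝ) : (Idx P d → ℝ) →L[ℝ] Amb P d :=
  ((PiLp.continuousLinearEquiv 2 ℝ fun _ : Fin P => EuclideanSpace ℝ (Fin (d + 1))).symm :
    (Fin P → EuclideanSpace ℝ (Fin (d + 1))) →L[ℝ] _) ∘L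
    ContinuousLinearMap.pi fun k => stereoDeriv (A k) (blockCoord k x) ∘L blockCoord k

lemma hasFDerivAt_param (A : SphProd P d) (x : Idx P d → ℝ) :
    HasFDerivAt (fun x => embed (coordInv A x)) (paramDeriv A x) x := by
  have h : HasFDerivAt (fun x k => stereo (A k) (blockCoord k x))
      (ContinuousLinearMap.pi fun k => stereoDeriv (A k) (blockCoord k x) ∘L blockCoord k) x :=
    hasFDerivAt_pi.2 fun k =>
      (hasFDerivAt_stereo (A k) (blockCoord k x)).comp x (blockCoord k).hasFDerivAt
  have h' := ((PiLp.continuousLinearEquiv 2 ℝ fun _ : Fin P =>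
    EuclideanSpace ℝ (Fin (d + 1))).symm.hasFDerivAt).comp x h
  refine h'.congr_of_eventuallyEq (Filter.Eventually.of_forall fun y => ?_)
  ext k : 1
  exact coordInv_coe A y k

lemma basisVec_eq (A : SphProd P d) (x : Idx P d → ℝ) (j : Idx P d) :
    basisVec A x j =
      incl j.1 (stereoDeriv (A j.1) (blockCoord j.1 x) (EuclideanSpace.single j.2 1)) := by
  rw [basisVec, partialDeriv, (hasFDerivAt_param A x).fderiv]
  ext k : 1
  change stereoDeriv (A k) (blockCoord k x) (blockCoord k (Pi.single j 1)) = _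
  rw [blockCoord_single, incl_apply]
  split_ifs with h
  · rw [h]
  · simp

lemma basisVec_zero (A : SphProd P d) (j : Idx P d) :
    basisVec A 0 j = incl j.1 (frame (A j.1) (EuclideanSpace.single j.2 1)) := by
  rw [basisVec_eq, map_zero, stereoDeriv_zero]

/-- Different blocks are orthogonal and each block is conformal, so inverse and determinant are
explicit. -/
lemma metricTensor_eq (A : SphProd P d) (x : Idx P d → ℝ) :
    metricTensor A x =
      Matrix.diagonal fun j => (4 / (‖blockCoord j.1 x‖ ^ 2 + 4)) ^ 2 := by
  ext i j
  rw [metricTensor, Matrix.of_apply, basisVec_eq, basisVec_eq, inner_incl_left, incl_apply,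
    Matrix.diagonal_apply]
  by_cases h : i.1 = j.1
  · obtain ⟨i1, i2⟩ := i
    obtain ⟨j1, j2⟩ := j
    simp only at h
    subst h
    simp only [if_true, inner_stereoDeriv]
    by_cases h2 : i2 = j2
    · subst h2
      simp
    · simp [h2, EuclideanSpace.inner_single_left]
  · have : i ≠ j := fun e => h (by rw [e])
    simp [h, this]

lemma metricTensor_inv (A : SphProd P d) (x : Idx P d → ℝ) :
    (metricTensor A x)⁻¹ =
      Matrix.diagonal fun j => ((‖blockCoord j.1 x‖ ^ 2 + 4) / 4) ^ 2 := by
  apply Matrix.inv_eq_right_inv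
  rw [metricTensor_eq, Matrix.diagonal_mul_diagonal, ← Matrix.diagonal_one]
  congr 1
  funext j
  have : ‖blockCoord j.1 x‖ ^ 2 + 4 ≠ 0 := by positivity
  field_simp

lemma component_eq (A : SphProd P d) (X : SphProd P d → Amb P d) (i : Idx P d)
    (x : Idx P d → ℝ) :
    component A X i x = ((‖blockCoord i.1 x‖ ^ 2 + 4) / 4) ^ 2 *
      inner ℝ (basisVec A x i) (X (coordInv A x)) := by
  simp only [component, metricTensor_inv, Matrix.diagonal_apply, ite_mul, zero_mul,
    Finset.sum_ite_eq, Finset.mem_univ, if_true]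

/-! ### Tangential projection and adapted orthonormal bases. -/

/-- The projection of a vector of the embedding space onto the tangent space at `A`. -/
def tangentPart (A : SphProd P d) (v : Amb P d) : Amb P d :=
  WithLp.toLp 2 fun k => v k - inner ℝ (A k : EuclideanSpace ℝ (Fin (d + 1))) (v k) •
    (A k : EuclideanSpace ℝ (Fin (d + 1)))

lemma tangentProj_eq (y v : EuclideanSpace ℝ (Fin (d + 1))) :
    tangentProj y v = v - inner ℝ y v • y := by
  ext i
  simp [tangentProj, Matrix.sub_mulVec, Matrix.vecMulVec_mulVec, PiLp.inner_apply, dotProduct,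
    mul_comm]

lemma orthonormal_frame (a : Sph d) :
    Orthonormal ℝ (fun o : Option (Fin d) => o.elim (a : EuclideanSpace ℝ (Fin (d + 1)))
      fun i => frame a (EuclideanSpace.single i 1)) := by
  rw [orthonormal_iff_ite]
  rintro (_ | i) (_ | j)
  · simp
  · simp [inner_frame_right]
  · simp [inner_frame_left]
  · simp [LinearIsometry.inner_map_map, EuclideanSpace.inner_single_left]

/-- The orthonormal basis formed by `a` and the frame of the tangent space at `a`. -/
def frameBasis (a : Sph d) :
    OrthonormalBasis (Option (Fin d)) ℝ (EuclideanSpace ℝ (Fin (d + 1))) :=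
  OrthonormalBasis.mk (orthonormal_frame a) <| by
    rw [(orthonormal_frame a).linearIndependent.span_eq_top_of_card_eq_finrank' (by simp)]

lemma frameBasis_none (a : Sph d) : frameBasis a none = a := by
  simp [frameBasis]

lemma frameBasis_some (a : Sph d) (i : Fin d) :
    frameBasis a (some i) = frame a (EuclideanSpace.single i 1) := by
  simp [frameBasis]

lemma sum_inner_frame (a : Sph d) (v : EuclideanSpace ℝ (Fin (d + 1))) :
    ∑ i, inner ℝ (frame a (EuclideanSpace.single i 1)) v • frame a (EuclideanSpace.single i 1) =
      v - inner ℝ (a : EuclideanSpace ℝ (Fin (d + 1))) v •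
        (a : EuclideanSpace ℝ (Fin (d + 1))) := by
  have h := (frameBasis a).sum_repr' v
  rw [Fintype.sum_option] at h
  simp only [frameBasis_none, frameBasis_some] at h
  exact eq_sub_of_add_eq' h

/-- At the centre the conformal factor is `1`, so the natural basis is an orthonormal basis of the
tangent space. -/
lemma sum_inner_basisVec (A : SphProd P d) (v : Amb P d) :
    ∑ j, inner ℝ (basisVec A 0 j) v • basisVec A 0 j = tangentPart A v := by
  rw [← sum_incl (tangentPart A v), Fintype.sum_prod_type]
  refine Finset.sum_congr rfl fun k _ => ?_
  simp only [basisVec_zero, inner_incl_left, ← (incl k).map_smul, ← map_sum (incl k),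
    sum_inner_frame]
  rfl

lemma inner_tangentPart (A : SphProd P d) (u v : Amb P d) :
    inner ℝ (tangentPart A u) v = inner ℝ u (tangentPart A v) := by
  rw [PiLp.inner_apply, PiLp.inner_apply]
  refine Finset.sum_congr rfl fun k _ => ?_
  simp only [tangentPart, inner_sub_left, inner_sub_right, inner_smul_left, inner_smul_right]
  rw [real_inner_comm (u k) (A k : EuclideanSpace ℝ (Fin (d + 1)))]
  simp only [conj_trivial]
  ring

lemma tangentPart_tangentPart (A : SphProd P d) (v : Amb P d) :
    tangentPart A (tangentPart A v) = tangentPart A v := by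
  ext k : 1
  simp only [tangentPart, inner_sub_right, inner_smul_right, inner_self_sph]
  simp

lemma tangentPart_basisVec (A : SphProd P d) (x : Idx P d → ℝ) (j : Idx P d) :
    tangentPart (coordInv A x) (basisVec A x j) = basisVec A x j := by
  ext k : 1
  simp only [tangentPart, basisVec_eq, incl_apply]
  split_ifs with h
  · subst h
    rw [coordInv_coe, real_inner_comm, ← blockCoord_apply, inner_stereoDeriv_stereo]
    simp
  · simp

/-! ### Gradient and action computed through extensions to the embedding space. -/

variable {f : SphProd P d → ℝ} {fe : Amb P d → ℝ}

lemma partialDeriv_extension (hf : ∀ A, fe (embed A) = f A) (A : SphProd P d) (x : Idx P d → ℝ)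
    (hd : DifferentiableAt ℝ fe (embed (coordInv A x))) (i : Idx P d) :
    partialDeriv (fun x => f (coordInv A x)) i x =
      fderiv ℝ fe (embed (coordInv A x)) (basisVec A x i) := by
  have h : (fun x => f (coordInv A x)) = fe ∘ fun x => embed (coordInv A x) := by
    funext x
    exact (hf _).symm
  rw [partialDeriv, h, fderiv_comp x hd (hasFDerivAt_param A x).differentiableAt]
  rfl

lemma grad_eq_sum (f : SphProd P d → ℝ) (A : SphProd P d) :
    grad f A = ∑ j, partialDeriv (fun x => f (coordInv A x)) j 0 • basisVec A 0 j := by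
  simp only [grad, coord_self, metricTensor_inv, Matrix.diagonal_apply, map_zero, norm_zero,
    ite_mul, zero_mul, Finset.sum_ite_eq', Finset.mem_univ, if_true]
  norm_num

lemma inner_gradient_left {V : Type*} [NormedAddCommGroup V] [InnerProductSpace ℝ V]
    [CompleteSpace V] (g : V → ℝ) (x v : V) : inner ℝ (∇ g x) v = fderiv ℝ g x v := by
  simp [gradient]

lemma inner_gradient_right {V : Type*} [NormedAddCommGroup V] [InnerProductSpace ℝ V]
    [CompleteSpace V] (g : V → ℝ) (x v : V) : inner ℝ v (∇ g x) = fderiv ℝ g x v := by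
  rw [real_inner_comm, inner_gradient_left]

/-- The Riemannian gradient is the tangential part of the gradient of any extension. -/
lemma grad_eq_tangentPart (hf : ∀ A, fe (embed A) = f A) (A : SphProd P d)
    (hd : DifferentiableAt ℝ fe (embed A)) :
    grad f A = tangentPart A (∇ fe (embed A)) := by
  rw [grad_eq_sum, ← sum_inner_basisVec]
  refine Finset.sum_congr rfl fun j _ => ?_
  rw [partialDeriv_extension hf A 0 (by rwa [coordInv_zero]), coordInv_zero, inner_gradient_right]

lemma act_eq (hf : ∀ A, fe (embed A) = f A) (A : SphProd P d)
    (hd : DifferentiableAt ℝ fe (embed A)) (X : SphProd P d → Amb P d) :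
    act X f A = fderiv ℝ fe (embed A) (tangentPart A (X A)) := by
  rw [← sum_inner_basisVec, map_sum, act, coord_self]
  refine Finset.sum_congr rfl fun j _ => ?_
  rw [partialDeriv_extension hf A 0 (by rwa [coordInv_zero]), coordInv_zero, component_eq,
    coordInv_zero, map_smul, smul_eq_mul, map_zero]
  norm_num

lemma act_grad_eq {h : SphProd P d → ℝ} {he : Amb P d → ℝ} (hf : ∀ A, fe (embed A) = f A)
    (hh : ∀ A, he (embed A) = h A) (A : SphProd P d)
    (hd : DifferentiableAt ℝ fe (embed A)) (hd' : DifferentiableAt ℝ he (embed A)) :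
    act (grad f) h A = fderiv ℝ fe (embed A) (tangentPart A (∇ he (embed A))) := by
  rw [act_eq hh A hd', grad_eq_tangentPart hf A hd, tangentPart_tangentPart,
    ← inner_gradient_left, ← inner_tangentPart, inner_gradient_right]

/-- Needed at every `x`, not only at the centre, because the divergence differentiates the
components. -/
lemma component_grad (hf : ∀ A, fe (embed A) = f A) (A : SphProd P d) (x : Idx P d → ℝ)
    (hd : DifferentiableAt ℝ fe (embed (coordInv A x))) (i : Idx P d) :
    component A (grad f) i x = ((‖blockCoord i.1 x‖ ^ 2 + 4) / 4) ^ 2 *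
      fderiv ℝ fe (embed (coordInv A x)) (basisVec A x i) := by
  rw [component_eq, grad_eq_tangentPart hf _ hd, ← inner_tangentPart, tangentPart_basisVec,
    inner_gradient_right]

/-! ### The Beltrami–Laplace operator and the generator. -/

/-- The volume density of the stereographic coordinates is stationary at the centre. -/
lemma hasFDerivAt_density (A : SphProd P d) (i : Idx P d) :
    HasFDerivAt (fun x => √(metricTensor A x).det * ((‖blockCoord i.1 x‖ ^ 2 + 4) / 4) ^ 2)
      (0 : (Idx P d → ℝ) →L[ℝ] ℝ) 0 := by
  have h0 : ∀ k : Fin P, HasFDerivAt (fun x : Idx P d → ℝ => ‖blockCoord k x‖ ^ 2 + 4)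
      (0 : (Idx P d → ℝ) →L[ℝ] ℝ) 0 := by
    intro k
    have h := ((hasStrictFDerivAt_norm_sq (blockCoord (d := d) k 0)).hasFDerivAt.comp 0
      (blockCoord (d := d) k).hasFDerivAt).add_const 4
    refine h.congr_fderiv ?_
    ext u
    simp
  have h1 : HasFDerivAt (fun x : Idx P d → ℝ => ((‖blockCoord i.1 x‖ ^ 2 + 4) / 4) ^ 2)
      (0 : (Idx P d → ℝ) →L[ℝ] ℝ) 0 := by
    have h := ((h0 i.1).mul_const (4 : ℝ)⁻¹).pow 2
    refine (h.congr_fderiv ?_)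
    simp
  have h2 : HasFDerivAt (fun x => (metricTensor A x).det) (0 : (Idx P d → ℝ) →L[ℝ] ℝ) 0 := by
    have h3 : ∀ j : Idx P d, HasFDerivAt
        (fun x : Idx P d → ℝ => (4 / (‖blockCoord j.1 x‖ ^ 2 + 4)) ^ 2)
        (0 : (Idx P d → ℝ) →L[ℝ] ℝ) 0 := by
      intro j
      have hne : ‖blockCoord (d := d) j.1 (0 : Idx P d → ℝ)‖ ^ 2 + 4 ≠ 0 := by positivity
      have h := ((((hasFDerivAt_inv hne).comp 0 (h0 j.1)).const_mul 4).pow 2)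
      refine (h.congr_fderiv ?_).congr_of_eventuallyEq
        (Filter.Eventually.of_forall fun x => ?_)
      · simp
      · simp [div_eq_mul_inv]
    have h4 := HasFDerivAt.finsetProd (u := Finset.univ) (x := (0 : Idx P d → ℝ))
      fun j _ => h3 j
    refine (h4.congr_fderiv ?_).congr_of_eventuallyEq (Filter.Eventually.of_forall fun x => ?_)
    · simp
    · simp only [metricTensor_eq, Matrix.det_diagonal]
  have hdet : (metricTensor A (0 : Idx P d → ℝ)).det = 1 := by
    simp [metricTensor_eq]
  have h5 := (h2.sqrt (by rw [hdet]; norm_num)).mul h1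
  refine h5.congr_fderiv ?_
  simp

/-- The second derivative of the parametrisation at its centre is purely normal, `(u, v) ↦ -⟨u, v⟩
a`: the second fundamental form of the sphere. It produces the `-d` in the drift. -/
lemma hasFDerivAt_stereoDeriv_apply (a : Sph d) (u : EuclideanSpace ℝ (Fin d)) :
    HasFDerivAt (fun w => stereoDeriv a w u)
      (-(innerSL ℝ u).smulRight (a : EuclideanSpace ℝ (Fin (d + 1)))) 0 := by
  have h1 : HasFDerivAt (fun w : EuclideanSpace ℝ (Fin d) => ‖w‖ ^ 2 + 4) (2 • innerSL ℝ 0) 0 :=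
    (hasStrictFDerivAt_norm_sq (0 : EuclideanSpace ℝ (Fin d))).hasFDerivAt.add_const 4
  have hs : ‖(0 : EuclideanSpace ℝ (Fin d))‖ ^ 2 + 4 ≠ 0 := by positivity
  have h2 := ((hasFDerivAt_inv hs).comp 0 h1)
  have h3 := (h2.const_mul 4).smul_const (frame a u)
  have h4 : HasFDerivAt (fun w => inner ℝ u w) (innerSL ℝ u) 0 := (innerSL ℝ u).hasFDerivAt
  have h5 := (((h2.pow 2).const_mul 8).mul h4).smul
    (((frame a).toContinuousLinearMap.hasFDerivAt (x := 0)).add_const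
      ((2 : ℝ) • (a : EuclideanSpace ℝ (Fin (d + 1)))))
  refine ((h3.sub h5).congr_fderiv ?_).congr_of_eventuallyEq
    (Filter.Eventually.of_forall fun w => ?_)
  · ext1 v
    simp
    match_scalars
    ring
  · simp [stereoDeriv, div_eq_mul_inv, real_inner_comm, smul_smul]
    ring_nf

/-- The density times the inverse metric is `1` with zero derivative at the centre, so only `∂ⱼ
(Df(∂ⱼ))` survives. The product rule splits it into the Hessian on `∂ⱼ` and `Df` on the
acceleration, which is `-A₍ₖ₎`, with `k` the block of `j`. -/
lemma beltrami_eq_frame (hf : ∀ A, fe (embed A) = f A)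
    (hs : ∀ A : SphProd P d, ContDiffAt ℝ 2 fe (embed A)) (A : SphProd P d) :
    beltrami f A = ∑ j : Idx P d,
      (fderiv ℝ (fderiv ℝ fe) (embed A) (basisVec A 0 j) (basisVec A 0 j) -
        fderiv ℝ fe (embed A) (incl j.1 (A j.1))) := by
  have hdet : (metricTensor A (0 : Idx P d → ℝ)).det = 1 := by
    simp [metricTensor_eq]
  rw [beltrami, div, coord_self, hdet, Real.sqrt_one, div_one]
  refine Finset.sum_congr rfl fun j _ => ?_
  have hfun : (fun x => √(metricTensor A x).det * component A (grad f) j x) = fun x =>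
      (√(metricTensor A x).det * ((‖blockCoord j.1 x‖ ^ 2 + 4) / 4) ^ 2) *
      fderiv ℝ fe (embed (coordInv A x)) (basisVec A x j) := by
    funext x
    rw [component_grad hf A x ((hs _).differentiableAt (by norm_num))]
    ring
  have hD : HasFDerivAt (fderiv ℝ fe) (fderiv ℝ (fderiv ℝ fe) (embed A))
      (embed (coordInv A 0)) := by
    rw [coordInv_zero]
    exact (((hs A).fderiv_right (m := 1) (by norm_num)).differentiableAt (by norm_num)).hasFDerivAt
  have h1 : HasFDerivAt (fun x => fderiv ℝ fe (embed (coordInv A x)))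
      (fderiv ℝ (fderiv ℝ fe) (embed A) ∘L paramDeriv A 0) 0 :=
    HasFDerivAt.comp (0 : Idx P d → ℝ) hD (hasFDerivAt_param A 0)
  have h2 : HasFDerivAt (fun x => basisVec A x j)
      ((incl j.1) ∘L (-(innerSL ℝ (EuclideanSpace.single j.2 (1 : ℝ))).smulRight
        (A j.1 : EuclideanSpace ℝ (Fin (d + 1)))) ∘L blockCoord j.1) 0 := by
    have h5 : HasFDerivAt (fun w => stereoDeriv (A j.1) w (EuclideanSpace.single j.2 1))
        (-(innerSL ℝ (EuclideanSpace.single j.2 (1 : ℝ))).smulRight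
          (A j.1 : EuclideanSpace ℝ (Fin (d + 1)))) (blockCoord (d := d) j.1 0) := by
      rw [map_zero]
      exact hasFDerivAt_stereoDeriv_apply _ _
    have h6 := (incl (P := P) j.1).hasFDerivAt.comp (0 : Idx P d → ℝ)
      (h5.comp (0 : Idx P d → ℝ) (blockCoord j.1).hasFDerivAt)
    exact h6.congr_of_eventuallyEq (Filter.Eventually.of_forall fun x => basisVec_eq A x j)
  have h3 := (hasFDerivAt_density A j).mul (h1.clm_apply h2)
  rw [partialDeriv, hfun]
  have h4 := HasFDerivAt.fderiv h3
  rw [Pi.mul_def] at h4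
  rw [h4]
  have hb : paramDeriv A 0 (Pi.single j 1) = basisVec A 0 j := by
    rw [basisVec, partialDeriv, (hasFDerivAt_param A 0).fderiv]
  simp [hdet, hb, blockCoord_single, coordInv_zero]
  ring

/-- Both sums are the trace of the Riesz representative of `T`. -/
lemma sum_bilin_orthonormalBasis {V ι ι' : Type*} [NormedAddCommGroup V] [InnerProductSpace ℝ V]
    [CompleteSpace V] [Fintype ι] [Fintype ι'] (b : OrthonormalBasis ι ℝ V)
    (b' : OrthonormalBasis ι' ℝ V) (T : V →L[ℝ] V →L[ℝ] ℝ) :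
    ∑ i, T (b i) (b i) = ∑ i, T (b' i) (b' i) := by
  let S : V →ₗ[ℝ] V :=
    { toFun := fun v => (InnerProductSpace.toDual ℝ V).symm (T v)
      map_add' := by simp
      map_smul' := by simp }
  have h : ∀ v, T v v = inner ℝ v (S v) := by
    intro v
    rw [real_inner_comm]
    simp [S]
  classical
  simp only [h]
  rw [← LinearMap.trace_eq_sum_inner, ← LinearMap.trace_eq_sum_inner]

/-- The drift of the Langevin generator, as a vector of the embedding space. -/
def drift (he : Amb P d → ℝ) (A : SphProd P d) : Amb P d :=
  tangentPart A (∇ he (embed A)) - (d : ℝ) • embed A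

/-- The generator `f ↦ (grad f)[h] + Δ f` in terms of extensions to the embedding space. -/
lemma generator_eq {h : SphProd P d → ℝ} {he : Amb P d → ℝ} (hf : ∀ A, fe (embed A) = f A)
    (hs : ∀ A : SphProd P d, ContDiffAt ℝ 2 fe (embed A))
    (hh : ∀ A, he (embed A) = h A) (A : SphProd P d)
    (hd' : DifferentiableAt ℝ he (embed A)) :
    act (grad f) h A + beltrami f A = fderiv ℝ fe (embed A) (drift he A) +
      ∑ k, (∑ i, fderiv ℝ (fderiv ℝ fe) (embed A) (incl k (EuclideanSpace.basisFun _ ℝ i))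
          (incl k (EuclideanSpace.basisFun _ ℝ i)) -
        fderiv ℝ (fderiv ℝ fe) (embed A) (incl k (A k)) (incl k (A k))) := by
  rw [act_grad_eq hf hh A ((hs A).differentiableAt (by norm_num)) hd', beltrami_eq_frame hf hs,
    drift, map_sub, map_smul]
  have h1 : fderiv ℝ fe (embed A) (embed A) =
      ∑ k, fderiv ℝ fe (embed A) (incl k (A k)) := by
    rw [← map_sum]
    congr 1
    exact (sum_incl (embed A)).symm
  -- The point `A k` completes the tangent frame to an orthonormal basis, so the tangential trace is
  -- the full trace minus the normal term.
  have h2 : ∀ k, ∑ i, fderiv ℝ (fderiv ℝ fe) (embed A) (incl k (EuclideanSpace.basisFun _ ℝ i))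
          (incl k (EuclideanSpace.basisFun _ ℝ i)) -
        fderiv ℝ (fderiv ℝ fe) (embed A) (incl k (A k)) (incl k (A k)) =
      ∑ i, fderiv ℝ (fderiv ℝ fe) (embed A) (basisVec A 0 (k, i)) (basisVec A 0 (k, i)) := by
    intro k
    have h3 := sum_bilin_orthonormalBasis (EuclideanSpace.basisFun (Fin (d + 1)) ℝ)
      (frameBasis (A k)) ((fderiv ℝ (fderiv ℝ fe) (embed A)).bilinearComp (incl k) (incl k))
    simp only [ContinuousLinearMap.bilinearComp_apply, Fintype.sum_option, frameBasis_none,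
      frameBasis_some] at h3
    rw [h3]
    simp only [basisVec_zero]
    ring
  rw [Finset.sum_congr rfl fun k _ => h2 k, h1, Fintype.sum_prod_type]
  simp only [Finset.sum_sub_distrib, Finset.sum_const, Finset.card_univ, Fintype.card_fin,
    nsmul_eq_mul, smul_eq_mul, Finset.mul_sum]
  ring

/-! ### Smoothness of Hilbert-space-valued maps with smooth Gram kernel. -/

lemma two_le_infty : (2 : WithTop ℕ∞) ≤ ∞ := WithTop.coe_le_coe.2 (le_top : (2 : ℕ∞) ≤ ⊤)

lemma three_le_infty : (3 : WithTop ℕ∞) ≤ ∞ := WithTop.coe_le_coe.2 (le_top : (3 : ℕ∞) ≤ ⊤)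

/-- The mixed second difference of a `C²` function is asymptotically bilinear. -/
lemma exists_mixed_difference_le {κ : ℝ × ℝ → ℝ} (hκ : ContDiffAt ℝ 2 κ (0, 0)) :
    ∃ c : ℝ, ∀ ε > 0, ∃ δ > 0, ∀ s t : ℝ, |s| < δ → |t| < δ →
      |κ (s, t) - κ (0, t) - (κ (s, 0) - κ (0, 0)) - c * (s * t)| ≤ ε * (|s| * |t|) := by
  have h2 : ContDiffAt ℝ 1 (fderiv ℝ κ) (0, 0) := hκ.fderiv_right (by norm_num)
  have h3 : ContDiffAt ℝ 0 (fderiv ℝ (fderiv ℝ κ)) (0, 0) := h2.fderiv_right (by norm_num)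
  -- The constant is the mixed partial at the origin. The mean value inequality is applied twice: in
  -- `s` to `∂ₜκ(s, t') - m(0, 0) s`, then in `t` to `κ(s, t) - κ(0, t) - m(0, 0) s t`.
  set m : ℝ × ℝ → ℝ := fun y => fderiv ℝ (fderiv ℝ κ) y (1, 0) (0, 1) with hm
  have hmc : ContinuousAt m (0, 0) :=
    (h3.continuousAt.clm_apply continuousAt_const).clm_apply continuousAt_const
  refine ⟨m (0, 0), fun ε hε => ?_⟩
  have e1 : ∀ᶠ y in nhds ((0, 0) : ℝ × ℝ), DifferentiableAt ℝ κ y :=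
    (hκ.eventually (by simp)).mono fun y hy => hy.differentiableAt (by norm_num)
  have e2 : ∀ᶠ y in nhds ((0, 0) : ℝ × ℝ), DifferentiableAt ℝ (fderiv ℝ κ) y :=
    (h2.eventually (by simp)).mono fun y hy => hy.differentiableAt (by norm_num)
  have e3 : ∀ᶠ y in nhds ((0, 0) : ℝ × ℝ), |m y - m (0, 0)| < ε :=
    (Metric.tendsto_nhds.1 hmc ε hε)
  obtain ⟨δ, hδ, hball⟩ := Metric.eventually_nhds_iff_ball.1 (e1.and (e2.and e3))
  have hball' : ∀ s t : ℝ, |s| < δ → |t| < δ → DifferentiableAt ℝ κ (s, t) ∧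
      DifferentiableAt ℝ (fderiv ℝ κ) (s, t) ∧ |m (s, t) - m (0, 0)| < ε := by
    intro s t hs ht
    apply hball
    rw [Metric.mem_ball, Prod.dist_eq]
    simpa using ⟨hs, ht⟩
  refine ⟨δ, hδ, fun s t hs ht => ?_⟩
  have hmem : ∀ r : ℝ, r ∈ Metric.ball (0 : ℝ) δ ↔ |r| < δ := by simp
  have inner_le : ∀ t' ∈ Metric.ball (0 : ℝ) δ,
      ‖fderiv ℝ κ (s, t') (0, 1) - fderiv ℝ κ (0, t') (0, 1) - m (0, 0) * s‖ ≤ ε * |s| := by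
    intro t' ht'
    have hd : ∀ s' ∈ Metric.ball (0 : ℝ) δ, HasDerivWithinAt
        (fun s' => fderiv ℝ κ (s', t') (0, 1) - m (0, 0) * s') (m (s', t') - m (0, 0))
        (Metric.ball 0 δ) s' := by
      intro s' hs'
      have h := (hball' s' t' ((hmem _).1 hs') ((hmem _).1 ht')).2.1.hasFDerivAt.comp_hasDerivAt s'
        ((hasDerivAt_id s').prodMk (hasDerivAt_const s' t'))
      have h' := h.clm_apply (hasDerivAt_const s' ((0, 1) : ℝ × ℝ))
      have h'' := h'.sub ((hasDerivAt_id s').const_mul (m (0, 0)))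
      refine HasDerivAt.hasDerivWithinAt (h''.congr_deriv ?_)
      simp [hm]
    have := Convex.norm_image_sub_le_of_norm_hasDerivWithin_le hd
      (fun s' hs' => (hball' s' t' ((hmem _).1 hs') ((hmem _).1 ht')).2.2.le)
      (convex_ball _ _) ((hmem 0).2 (by simpa using hδ)) ((hmem s).2 hs)
    simp only [sub_zero, mul_zero, Real.norm_eq_abs] at this ⊢
    refine le_trans (le_of_eq ?_) this
    congr 1
    ring
  have hd : ∀ t' ∈ Metric.ball (0 : ℝ) δ, HasDerivWithinAt
      (fun t' => κ (s, t') - κ (0, t') - m (0, 0) * s * t')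
      (fderiv ℝ κ (s, t') (0, 1) - fderiv ℝ κ (0, t') (0, 1) - m (0, 0) * s)
      (Metric.ball 0 δ) t' := by
    intro t' ht'
    have h := fun (r : ℝ) (hr : |r| < δ) =>
      (hball' r t' hr ((hmem _).1 ht')).1.hasFDerivAt.comp_hasDerivAt t'
      ((hasDerivAt_const t' r).prodMk (hasDerivAt_id t'))
    have h' := ((h s hs).sub (h 0 (by simpa using hδ))).sub
      ((hasDerivAt_id t').const_mul (m (0, 0) * s))
    refine HasDerivAt.hasDerivWithinAt (h'.congr_deriv ?_)
    simp
  have := Convex.norm_image_sub_le_of_norm_hasDerivWithin_le hd inner_le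
      (convex_ball _ _) ((hmem 0).2 (by simpa using hδ)) ((hmem t).2 ht)
  simp only [sub_zero, mul_zero, Real.norm_eq_abs] at this
  rw [← mul_assoc ε]
  refine le_trans (le_of_eq ?_) this
  congr 1
  ring

variable {V H : Type*} [NormedAddCommGroup V] [NormedSpace ℝ V]
  [NormedAddCommGroup H] [InnerProductSpace ℝ H]

/-- A curve in a Hilbert space with a `C²` Gram function is differentiable. -/
lemma exists_hasDerivAt_of_contDiffAt_gram [CompleteSpace H] {γ : ℝ → H}
    (h : ContDiffAt ℝ 2 (fun p : ℝ × ℝ => inner ℝ (γ p.1) (γ p.2)) (0, 0)) :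
    ∃ γ', HasDerivAt γ γ' 0 := by
  obtain ⟨c, hc⟩ := exists_mixed_difference_le h
  suffices hC : Cauchy (Filter.map (slope γ 0) (nhdsWithin 0 {0}ᶜ)) by
    obtain ⟨γ', hγ'⟩ := cauchy_map_iff_exists_tendsto.1 hC
    exact ⟨γ', hasDerivAt_iff_tendsto_slope.2 hγ'⟩
  rw [Metric.cauchy_iff]
  refine ⟨inferInstance, fun ε hε => ?_⟩
  -- The squared distance of two slopes is `G(s,s) - 2 G(s,t) + G(t,t)`, where each `G` is within
  -- `ε² / 8` of the same `c`; the total error is at most `ε² / 2 < ε²`.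
  obtain ⟨δ, hδ, hest⟩ := hc (ε ^ 2 / 8) (by positivity)
  have hgram : ∀ s t : ℝ, s ≠ 0 → t ≠ 0 → |s| < δ → |t| < δ →
      |inner ℝ (slope γ 0 s) (slope γ 0 t) - c| ≤ ε ^ 2 / 8 := by
    intro s t hs0 ht0 hs ht
    have h1 := hest s t hs ht
    have h2 : inner ℝ (slope γ 0 s) (slope γ 0 t) - c = (s * t)⁻¹ *
        (inner ℝ (γ s) (γ t) - inner ℝ (γ 0) (γ t) - (inner ℝ (γ s) (γ 0) - inner ℝ (γ 0) (γ 0))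
          - c * (s * t)) := by
      simp only [slope_def_module, sub_zero, inner_smul_left, inner_smul_right, inner_sub_left,
        inner_sub_right, conj_trivial]
      field_simp
    rw [h2, abs_mul, abs_inv, abs_mul, inv_mul_le_iff₀ (by positivity), mul_comm _ (ε ^ 2 / 8)]
    exact h1
  refine ⟨slope γ 0 '' {s | s ≠ 0 ∧ |s| < δ}, ?_, ?_⟩
  · apply Filter.image_mem_map
    rw [mem_nhdsWithin_iff_exists_mem_nhds_inter]
    refine ⟨Metric.ball 0 δ, Metric.ball_mem_nhds _ hδ, fun s hs => ⟨hs.2, by simpa using hs.1⟩⟩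
  · rintro _ ⟨s, ⟨hs0, hs⟩, rfl⟩ _ ⟨t, ⟨ht0, ht⟩, rfl⟩
    rw [dist_eq_norm]
    have h3 : ‖slope γ 0 s - slope γ 0 t‖ ^ 2 < ε ^ 2 := by
      rw [norm_sub_sq_real, ← real_inner_self_eq_norm_sq, ← real_inner_self_eq_norm_sq]
      have a1 := abs_le.1 (hgram s s hs0 hs0 hs hs)
      have a2 := abs_le.1 (hgram s t hs0 ht0 hs ht)
      have a3 := abs_le.1 (hgram t t ht0 ht0 ht ht)
      have : 0 < ε ^ 2 := by positivity
      linarith [a1.2, a2.1, a3.2]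
    exact lt_of_pow_lt_pow_left₀ 2 hε.le h3

/-- The second difference of a continuous field of bilinear forms along two coinciding points is
small. -/
lemma eventually_second_difference_le {X : Type*} [TopologicalSpace X] {M : V → V →L[ℝ] V →L[ℝ] ℝ}
    {a b c : X → V} {x : X} (hM : ContinuousAt M (a x)) (ha : ContinuousAt a x)
    (hb : ContinuousAt b x) (hc : ContinuousAt c x) (hab : b x = a x) (hac : c x = a x)
    {ε : ℝ} (hε : 0 < ε) :
    ∀ᶠ w in nhds x, ∀ p q, M (a w) p q - M (b w) p q - M (c w) p q + M (a x) p q ≤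
      ε * ‖p‖ * ‖q‖ := by
  have c1 : ContinuousAt (fun w => M (a w)) x := hM.comp ha
  have c2 : ContinuousAt (fun w => M (b w)) x := by
    rw [← hab] at hM
    exact hM.comp hb
  have c3 : ContinuousAt (fun w => M (c w)) x := by
    rw [← hac] at hM
    exact hM.comp hc
  have hcont : ContinuousAt (fun w => ‖M (a w) - M (b w) - M (c w) + M (a x)‖) x :=
    (((c1.sub c2).sub c3).add continuousAt_const).norm
  have h0 : ‖M (a x) - M (b x) - M (c x) + M (a x)‖ < ε := by
    have : M (a x) - M (a x) - M (a x) + M (a x) = 0 := by abel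
    rw [hab, hac, this, norm_zero]
    exact hε
  filter_upwards [hcont.eventually_lt continuousAt_const h0] with w hw p q
  have h1 := ContinuousLinearMap.le_opNorm₂ (M (a w) - M (b w) - M (c w) + M (a x)) p q
  have h2 := (le_abs_self _).trans h1
  simp only [add_apply, sub_apply] at h2
  refine h2.trans ?_
  gcongr

/-- A feature map with `C²` kernel on an open set is differentiable there. -/
lemma exists_hasFDerivAt_of_contDiffOn_kernel [CompleteSpace H] [FiniteDimensional ℝ V]
    {U : Set V} (hU : IsOpen U) {φ : V → H}
    (hk : ContDiffOn ℝ 2 (fun z : V × V => inner ℝ (φ z.1) (φ z.2)) (U ×ˢ U)) :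
    ∀ z ∈ U, ∃ L : V →L[ℝ] H, HasFDerivAt φ L z := by
  set k : V × V → ℝ := fun z => inner ℝ (φ z.1) (φ z.2) with hkdef
  have hUU : IsOpen (U ×ˢ U) := hU.prod hU
  have hkat : ∀ z ∈ U, ∀ w ∈ U, ContDiffAt ℝ 2 k (z, w) := fun z hz w hw =>
    hk.contDiffAt (hUU.mem_nhds ⟨hz, hw⟩)
  -- Along a line the Gram function is a restriction of `k`, so all line derivatives exist in `H`.
  have hline : ∀ z ∈ U, ∀ v : V, ∃ ψ, HasLineDerivAt ℝ φ ψ z v := by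
    intro z hz v
    apply exists_hasDerivAt_of_contDiffAt_gram
    have hz' : ContDiffAt ℝ 2 k (z + (0 : ℝ) • v, z + (0 : ℝ) • v) := by
      simpa using hkat z hz z hz
    have hc : ContDiffAt ℝ 2 (fun p : ℝ × ℝ => (z + p.1 • v, z + p.2 • v)) (0, 0) := by
      fun_prop
    exact ContDiffAt.comp ((0, 0) : ℝ × ℝ) hz' hc
  have hline' : ∀ (z : V) (v : V), ∃ ψ, z ∈ U → HasLineDerivAt ℝ φ ψ z v := by
    intro z v
    by_cases hz : z ∈ U
    · obtain ⟨ψ, hψ⟩ := hline z hz v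
      exact ⟨ψ, fun _ => hψ⟩
    · exact ⟨0, fun h => absurd h hz⟩
  choose ψ hψ using hline'
  have hcurve : ∀ (z v : V), HasDerivAt (fun t : ℝ => z + t • v) v 0 := by
    intro z v
    simpa using ((hasDerivAt_id (0 : ℝ)).smul_const v).const_add z
  have hψφ : ∀ z ∈ U, ∀ w ∈ U, ∀ v, inner ℝ (ψ z v) (φ w) = fderiv ℝ k (z, w) (v, 0) := by
    intro z hz w hw v
    have h1 : HasDerivAt (fun t : ℝ => inner ℝ (φ (z + t • v)) (φ w)) (inner ℝ (ψ z v) (φ w)) 0 := by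
      simpa using HasDerivAt.inner ℝ (hψ z v hz) (hasDerivAt_const (0 : ℝ) (φ w))
    have hd : HasFDerivAt k (fderiv ℝ k (z, w)) (z + (0 : ℝ) • v, w) := by
      simpa using ((hkat z hz w hw).differentiableAt (by norm_num)).hasFDerivAt
    have h2 : HasDerivAt (fun t : ℝ => k (z + t • v, w)) (fderiv ℝ k (z, w) (v, 0)) 0 :=
      HasFDerivAt.comp_hasDerivAt (0 : ℝ) (f := fun t : ℝ => (z + t • v, w)) hd
        ((hcurve z v).prodMk (hasDerivAt_const (0 : ℝ) w))
    exact h1.unique h2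
  set M : V × V → V × V →L[ℝ] V × V →L[ℝ] ℝ := fderiv ℝ (fderiv ℝ k) with hM
  have hk1 : ∀ z ∈ U, ∀ w ∈ U, ContDiffAt ℝ 1 (fderiv ℝ k) (z, w) := fun z hz w hw =>
    (hkat z hz w hw).fderiv_right (by norm_num)
  have hψψ : ∀ z ∈ U, ∀ w ∈ U, ∀ v u, inner ℝ (ψ z v) (ψ w u) = M (z, w) (0, u) (v, 0) := by
    intro z hz w hw v u
    have h1 : HasDerivAt (fun t : ℝ => inner ℝ (ψ z v) (φ (w + t • u)))
        (inner ℝ (ψ z v) (ψ w u)) 0 := by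
      simpa using HasDerivAt.inner ℝ (hasDerivAt_const (0 : ℝ) (ψ z v)) (hψ w u hw)
    have hd : HasFDerivAt (fderiv ℝ k) (M (z, w)) (z, w + (0 : ℝ) • u) := by
      simpa using ((hk1 z hz w hw).differentiableAt (by norm_num)).hasFDerivAt
    have h2' : HasDerivAt (fun t : ℝ => fderiv ℝ k (z, w + t • u)) (M (z, w) (0, u)) 0 :=
      HasFDerivAt.comp_hasDerivAt (0 : ℝ) (f := fun t : ℝ => (z, w + t • u)) hd
        ((hasDerivAt_const (0 : ℝ) z).prodMk (hcurve w u))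
    have h2 : HasDerivAt (fun t : ℝ => fderiv ℝ k (z, w + t • u) (v, 0))
        (M (z, w) (0, u) (v, 0)) 0 := by
      simpa using h2'.clm_apply (hasDerivAt_const (0 : ℝ) ((v, 0) : V × V))
    have h3 : (fun t : ℝ => inner ℝ (ψ z v) (φ (w + t • u))) =ᶠ[nhds 0]
        fun t => fderiv ℝ k (z, w + t • u) (v, 0) := by
      have : ∀ᶠ t : ℝ in nhds 0, w + t • u ∈ U := by
        apply (hcurve w u).continuousAt.eventually_mem
        simpa using hU.mem_nhds hw
      exact this.mono fun t ht => hψφ z hz _ ht v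
    exact h1.unique (h2.congr_of_eventuallyEq h3)
  have hzero : ∀ x : H, inner ℝ x x = 0 → x = 0 := fun x hx => inner_self_eq_zero.1 hx
  intro z hz
  have hadd : ∀ v u, ψ z (v + u) = ψ z v + ψ z u := by
    intro v u
    -- The additivity defect is a combination of vectors `ψ z x` and is orthogonal to all of them,
    -- because their inner products are values of the bilinear `M`; so it vanishes.
    have hx : ∀ x, inner ℝ (ψ z x) (ψ z (v + u) - (ψ z v + ψ z u)) = 0 := by
      intro x
      rw [inner_sub_right, inner_add_right, hψψ z hz z hz, hψψ z hz z hz, hψψ z hz z hz,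
        show ((0 : V), v + u) = (0, v) + (0, u) by simp, map_add]
      simp
    refine sub_eq_zero.1 (hzero _ ?_)
    rw [inner_sub_left, inner_add_left, hx, hx, hx]
    simp
  have hsmul : ∀ (c : ℝ) v, ψ z (c • v) = c • ψ z v := by
    intro c v
    have hx : ∀ x, inner ℝ (ψ z x) (ψ z (c • v) - c • ψ z v) = 0 := by
      intro x
      rw [inner_sub_right, inner_smul_right, hψψ z hz z hz, hψψ z hz z hz,
        show ((0 : V), c • v) = c • (0, v) by simp, map_smul]
      simp
    refine sub_eq_zero.1 (hzero _ ?_)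
    rw [inner_sub_left, inner_smul_left, hx, hx]
    simp
  let L₀ : V →ₗ[ℝ] H := { toFun := ψ z, map_add' := hadd, map_smul' := hsmul }
  refine ⟨L₀.toContinuousLinearMap, ?_⟩
  rw [hasFDerivAt_iff_isLittleO_nhds_zero, Asymptotics.isLittleO_iff]
  intro ε hε
  have hMc : ∀ a ∈ U, ∀ b ∈ U, ContinuousAt M (a, b) := fun a ha b hb =>
    ((hk1 a ha b hb).fderiv_right (m := 0) (by norm_num)).continuousAt
  -- `‖ψ w v - ψ z v‖²` is the second difference of `M` over `(w,w), (w,z), (z,w), (z,z)`, so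
  -- continuity of `M` on the diagonal makes `ψ` continuous in its base point, uniformly over unit
  -- `v`.
  have hsmall := eventually_second_difference_le (M := M) (x := z) (a := fun w => (w, w))
    (b := fun w => (w, z)) (c := fun w => (z, w)) (hMc z hz z hz) (by fun_prop) (by fun_prop)
    (by fun_prop) rfl rfl (show 0 < ε ^ 2 by positivity)
  obtain ⟨δ, hδ, hball⟩ := Metric.eventually_nhds_iff_ball.1 (hsmall.and (hU.mem_nhds hz))
  filter_upwards [Metric.ball_mem_nhds (0 : V) hδ] with v hv
  have hv' : ‖v‖ < δ := by simpa using hv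
  have hmem : ∀ t ∈ Set.Icc (0 : ℝ) 1, z + t • v ∈ Metric.ball z δ := by
    intro t ht
    rw [Metric.mem_ball, dist_eq_norm, add_sub_cancel_left, norm_smul, Real.norm_eq_abs,
      abs_of_nonneg ht.1]
    exact lt_of_le_of_lt (mul_le_of_le_one_left (norm_nonneg v) ht.2) hv'
  -- The mean value inequality on the segment from `z` to `z + v`, with the linear part subtracted,
  -- turns this continuity into Fréchet differentiability.
  have hder : ∀ t ∈ Set.Icc (0 : ℝ) 1, HasDerivWithinAt (fun t : ℝ => φ (z + t • v) - t • ψ z v)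
      (ψ (z + t • v) v - ψ z v) (Set.Icc 0 1) t := by
    intro t ht
    have h1 := hψ (z + t • v) v (hball _ (hmem t ht)).2
    have h2 : HasDerivAt (fun s : ℝ => φ (z + s • v)) (ψ (z + t • v) v) t := by
      have h3 : HasDerivAt (fun r : ℝ => φ (z + t • v + r • v)) (ψ (z + t • v) v) (t - t) := by
        rw [sub_self]
        exact h1
      have h4 := HasDerivAt.comp_sub_const t t h3
      refine h4.congr_of_eventuallyEq (Filter.Eventually.of_forall fun s => ?_)
      simp only
      congr 1
      module
    have h5 := h2.sub ((hasDerivAt_id t).smul_const (ψ z v))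
    exact (h5.congr_deriv (by simp)).hasDerivWithinAt
  have hbound : ∀ t ∈ Set.Ico (0 : ℝ) 1, ‖ψ (z + t • v) v - ψ z v‖ ≤ ε * ‖v‖ := by
    intro t ht
    set w := z + t • v with hw
    obtain ⟨hw1, hw2⟩ := hball w (hmem t ⟨ht.1, ht.2.le⟩)
    refine le_of_sq_le_sq ?_ (by positivity)
    rw [norm_sub_sq_real, ← real_inner_self_eq_norm_sq, ← real_inner_self_eq_norm_sq, two_mul,
      ← sub_sub]
    nth_rewrite 3 [real_inner_comm]
    rw [hψψ w hw2 w hw2, hψψ z hz z hz, hψψ w hw2 z hz, hψψ z hz w hw2]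
    have h1 := hw1 (0, v) (v, 0)
    have h2 : ‖((0, v) : V × V)‖ = ‖v‖ := by simp [Prod.norm_def]
    have h3 : ‖((v, 0) : V × V)‖ = ‖v‖ := by simp [Prod.norm_def]
    rw [h2, h3] at h1
    refine h1.trans (le_of_eq ?_)
    ring
  have := norm_image_sub_le_of_norm_deriv_le_segment_01' hder hbound
  simp only [one_smul, zero_smul, add_zero, sub_zero] at this
  rw [sub_right_comm]
  exact this

/-- A feature map with smooth kernel on an open set is smooth there. -/
theorem contDiffOn_of_contDiffOn_kernel [CompleteSpace H] [FiniteDimensional ℝ V]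
    {U : Set V} (hU : IsOpen U) (n : ℕ) {φ : V → H}
    (hk : ContDiffOn ℝ ∞ (fun z : V × V => inner ℝ (φ z.1) (φ z.2)) (U ×ˢ U)) :
    ContDiffOn ℝ n φ U := by
  induction n generalizing φ with
  | zero =>
    have hd : DifferentiableOn ℝ φ U := fun z hz => by
      obtain ⟨L, hL⟩ := exists_hasFDerivAt_of_contDiffOn_kernel hU
        (hk.of_le two_le_infty) z hz
      exact hL.differentiableAt.differentiableWithinAt
    exact contDiffOn_zero.2 hd.continuousOn
  | succ n ih =>
    have hUU : IsOpen (U ×ˢ U) := hU.prod hU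
    have hd : ∀ z ∈ U, DifferentiableAt ℝ φ z := fun z hz => by
      obtain ⟨L, hL⟩ := exists_hasFDerivAt_of_contDiffOn_kernel hU
        (hk.of_le two_le_infty) z hz
      exact hL.differentiableAt
    push_cast
    refine contDiffOn_succ_of_fderiv_apply (fun z hz => (hd z hz).differentiableWithinAt)
      (by simp) fun v => ?_
    -- The directional derivative of `φ` is again a feature map, with kernel obtained by
    -- differentiating `k` once in each slot along `v`. That kernel is still `C^∞`, so the induction
    -- loses nothing.
    refine (ih (φ := fun z => fderiv ℝ φ z v) ?_).congr fun z hz => by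
      rw [fderivWithin_of_isOpen hU hz]
    set k : V × V → ℝ := fun z => inner ℝ (φ z.1) (φ z.2) with hkdef
    have hk1 : ContDiffOn ℝ ∞ (fderiv ℝ k) (U ×ˢ U) := hk.fderiv_of_isOpen hUU (by simp)
    have hk2 : ContDiffOn ℝ ∞ (fun y => fderiv ℝ k y (v, 0)) (U ×ˢ U) :=
      hk1.clm_apply contDiffOn_const
    have hk3 : ContDiffOn ℝ ∞ (fun y => fderiv ℝ (fun y => fderiv ℝ k y (v, 0)) y (0, v))
        (U ×ˢ U) := (hk2.fderiv_of_isOpen hUU (by simp)).clm_apply contDiffOn_const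
    have e1 : ∀ y ∈ U ×ˢ U, fderiv ℝ k y (v, 0) = inner ℝ (fderiv ℝ φ y.1 v) (φ y.2) := by
      rintro ⟨z, w⟩ ⟨hz, hw⟩
      have h1 := ((hd z hz).hasFDerivAt.comp (z, w) hasFDerivAt_fst).inner ℝ
        ((hd w hw).hasFDerivAt.comp (z, w) hasFDerivAt_snd)
      have h2 : fderiv ℝ k (z, w) = _ := HasFDerivAt.fderiv h1
      rw [h2]
      simp
    refine hk3.congr ?_
    rintro ⟨z, w⟩ ⟨hz, hw⟩
    have hdk : DifferentiableAt ℝ (fun y => fderiv ℝ k y (v, 0)) (z, w) :=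
      (hk2.contDiffAt (hUU.mem_nhds ⟨hz, hw⟩)).differentiableAt (by simp)
    have hc : HasFDerivAt (fun w' : V => ((z, w') : V × V)) (ContinuousLinearMap.inr ℝ V V) w :=
      hasFDerivAt_prodMk_right z w
    have h4 := hdk.hasFDerivAt.comp w hc
    have h5 : HasFDerivAt (fun w' => inner ℝ (fderiv ℝ φ z v) (φ w'))
        ((innerSL ℝ (fderiv ℝ φ z v)) ∘L fderiv ℝ φ w) w :=
      (innerSL ℝ (fderiv ℝ φ z v)).hasFDerivAt.comp w (hd w hw).hasFDerivAt
    have h6 : (fun w' => inner ℝ (fderiv ℝ φ z v) (φ w')) =ᶠ[nhds w]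
        (fun y => fderiv ℝ k y (v, 0)) ∘ fun w' => ((z, w') : V × V) := by
      filter_upwards [hU.mem_nhds hw] with w' hw'
      exact (e1 (z, w') ⟨hz, hw'⟩).symm
    have h7 := h5.unique (h4.congr_of_eventuallyEq h6)
    have h8 := DFunLike.congr_fun h7 v
    simpa using h8

/-! ### Radial retraction onto the product of spheres. -/

lemma continuous_embed : Continuous (embed : SphProd P d → Amb P d) := by
  unfold embed
  fun_prop

/-- The radial projection onto the sphere. -/
def normalizeSph (v : EuclideanSpace ℝ (Fin (d + 1))) : Sph d :=
  if h : v = 0 then ⟨EuclideanSpace.single 0 1, by simp⟩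
  else ⟨‖v‖⁻¹ • v, by simp [norm_smul, h]⟩

lemma coe_normalizeSph {v : EuclideanSpace ℝ (Fin (d + 1))} (h : v ≠ 0) :
    (normalizeSph v : EuclideanSpace ℝ (Fin (d + 1))) = ‖v‖⁻¹ • v := by
  simp [normalizeSph, h]

/-- The blockwise radial projection onto the product of spheres. -/
def retract (z : Amb P d) : SphProd P d := fun k => normalizeSph (z k)

/-- The domain on which `retract` is smooth. -/
def nonzeroBlocks (P d : ℕ) : Set (Amb P d) := {z | ∀ k, z k ≠ 0}

lemma isOpen_nonzeroBlocks : IsOpen (nonzeroBlocks P d) := by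
  have : nonzeroBlocks P d = ⋂ k, {z : Amb P d | z k ≠ 0} := by
    ext z
    simp [nonzeroBlocks]
  rw [this]
  exact isOpen_iInter_of_finite fun k => isOpen_ne_fun (by fun_prop) continuous_const

lemma sph_ne_zero (a : Sph d) : (a : EuclideanSpace ℝ (Fin (d + 1))) ≠ 0 :=
  ne_zero_of_mem_unit_sphere a

lemma embed_mem_nonzeroBlocks (A : SphProd P d) : embed A ∈ nonzeroBlocks P d :=
  fun k => sph_ne_zero (A k)

lemma retract_embed (A : SphProd P d) : retract (embed A) = A := by
  funext k
  apply Subtype.ext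
  change (normalizeSph (A k : EuclideanSpace ℝ (Fin (d + 1))) :
    EuclideanSpace ℝ (Fin (d + 1))) = _
  rw [coe_normalizeSph (sph_ne_zero _)]
  simp

lemma coe_retract {z : Amb P d} (hz : z ∈ nonzeroBlocks P d) (k : Fin P) :
    (retract z k : EuclideanSpace ℝ (Fin (d + 1))) = ‖z k‖⁻¹ • z k :=
  coe_normalizeSph (hz k)

lemma contDiff_block (k : Fin P) {n : WithTop ℕ∞} : ContDiff ℝ n (fun z : Amb P d => z k) :=
  (PiLp.proj 2 (fun _ : Fin P => EuclideanSpace ℝ (Fin (d + 1))) k (𝕜 := ℝ)).contDiff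

lemma contDiffAt_coe_retract {z : Amb P d} (hz : z ∈ nonzeroBlocks P d) (k : Fin P)
    {n : WithTop ℕ∞} :
    ContDiffAt ℝ n (fun z : Amb P d => (retract z k : EuclideanSpace ℝ (Fin (d + 1)))) z := by
  have h1 : ContDiffAt ℝ n (fun z : Amb P d => ‖z k‖⁻¹ • z k) z :=
    (((contDiff_block k).contDiffAt.norm ℝ (hz k)).inv (norm_ne_zero_iff.2 (hz k))).smul
      (contDiff_block k).contDiffAt
  refine h1.congr_of_eventuallyEq ?_
  filter_upwards [isOpen_nonzeroBlocks.mem_nhds hz] with w hw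
  exact coe_retract hw k

/-- Pulling back along the retraction, rather than using `κe` off the manifold, keeps the function a
Gram kernel of vectors of `H`, while smoothness of `κe` is needed only at points of the spheres. -/
lemma contDiffOn_prodKernel_retract {κ : Fin P → Sph d → Sph d → ℝ}
    {κe : Fin P → EuclideanSpace ℝ (Fin (d + 1)) → EuclideanSpace ℝ (Fin (d + 1)) → ℝ}
    (hκe : ∀ k (a b : Sph d), κe k a b = κ k a b)
    (hκe_smooth : ∀ k (a b : Sph d), ContDiffAt ℝ ∞
      (fun w : EuclideanSpace ℝ (Fin (d + 1)) × EuclideanSpace ℝ (Fin (d + 1)) => κe k w.1 w.2)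
      ((a : EuclideanSpace ℝ (Fin (d + 1))), (b : EuclideanSpace ℝ (Fin (d + 1))))) :
    ContDiffOn ℝ ∞ (fun z : Amb P d × Amb P d => prodKernel κ (retract z.1) (retract z.2))
      (nonzeroBlocks P d ×ˢ nonzeroBlocks P d) := by
  rintro ⟨z, w⟩ ⟨hz, hw⟩
  apply ContDiffAt.contDiffWithinAt
  unfold prodKernel
  refine contDiffAt_prod fun k _ => ?_
  simp only [← hκe]
  have h1 : ContDiffAt ℝ ∞ (fun y : Amb P d × Amb P d =>
      ((retract y.1 k : EuclideanSpace ℝ (Fin (d + 1))),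
        (retract y.2 k : EuclideanSpace ℝ (Fin (d + 1))))) (z, w) :=
    ((contDiffAt_coe_retract hz k).comp (z, w) contDiffAt_fst).prodMk
      ((contDiffAt_coe_retract hw k).comp (z, w) contDiffAt_snd)
  exact (hκe_smooth k (retract z k) (retract w k)).comp (z, w) h1

/-! ### The feature map and the generator on the reproducing kernel Hilbert space. -/

section FeatureMap

variable (H : Type*) [NormedAddCommGroup H] [InnerProductSpace ℝ H] [CompleteSpace H]
  [RKHS ℝ H (SphProd P d) ℝ]

/-- The feature map of a reproducing kernel Hilbert space, extended to the embedding space. -/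
def feature (z : Amb P d) : H := RKHS.kerFun H (retract z) (1 : ℝ)

variable {H}

lemma inner_feature (f : H) (z : Amb P d) : inner ℝ f (feature H z) = f (retract z) := by
  rw [feature, RKHS.inner_kerFun]
  simp

lemma contDiffOn_feature {K : SphProd P d → SphProd P d → ℝ}
    (hH : ∀ A B, RKHS.kernel H A B 1 = K A B)
    (hK : ContDiffOn ℝ ∞ (fun z : Amb P d × Amb P d => K (retract z.1) (retract z.2))
      (nonzeroBlocks P d ×ˢ nonzeroBlocks P d)) (n : ℕ) :
    ContDiffOn ℝ n (feature H) (nonzeroBlocks P d) := by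
  refine contDiffOn_of_contDiffOn_kernel isOpen_nonzeroBlocks n (hK.congr fun z _ => ?_)
  rw [real_inner_comm, inner_feature, feature, RKHS.kerFun_apply, hH]

/-- The generator applied to the feature map. -/
def generatorFeature (H : Type*) [NormedAddCommGroup H] [InnerProductSpace ℝ H] [CompleteSpace H]
    [RKHS ℝ H (SphProd P d) ℝ] (he : Amb P d → ℝ) (A : SphProd P d) : H :=
  fderiv ℝ (feature H) (embed A) (drift he A) +
    ∑ k, (∑ i, fderiv ℝ (fderiv ℝ (feature H)) (embed A)
          (incl k (EuclideanSpace.basisFun _ ℝ i)) (incl k (EuclideanSpace.basisFun _ ℝ i)) -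
        fderiv ℝ (fderiv ℝ (feature H)) (embed A) (incl k (A k)) (incl k (A k)))

lemma contDiffAt_feature (hΦ : ContDiffOn ℝ 2 (feature H) (nonzeroBlocks P d))
    (A : SphProd P d) : ContDiffAt ℝ 2 (feature H) (embed A) :=
  hΦ.contDiffAt (isOpen_nonzeroBlocks.mem_nhds (embed_mem_nonzeroBlocks A))

lemma contDiffAt_inner_feature (hΦ : ContDiffOn ℝ 2 (feature H) (nonzeroBlocks P d))
    (f : H) (A : SphProd P d) :
    ContDiffAt ℝ 2 (fun z => inner ℝ f (feature H z)) (embed A) :=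
  contDiffAt_const.inner ℝ (contDiffAt_feature hΦ A)

lemma fderiv_inner_feature (hΦ : ContDiffOn ℝ 2 (feature H) (nonzeroBlocks P d))
    (f : H) {z : Amb P d} (hz : z ∈ nonzeroBlocks P d) (v : Amb P d) :
    fderiv ℝ (fun z => inner ℝ f (feature H z)) z v = inner ℝ f (fderiv ℝ (feature H) z v) := by
  have h := ((hΦ.contDiffAt (isOpen_nonzeroBlocks.mem_nhds hz)).differentiableAt
    (by norm_num)).hasFDerivAt
  have h2 : HasFDerivAt (fun z => inner ℝ f (feature H z))
      ((innerSL ℝ f) ∘L fderiv ℝ (feature H) z) z := (innerSL ℝ f).hasFDerivAt.comp z h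
  rw [h2.fderiv]
  simp

lemma fderiv_fderiv_inner_feature (hΦ : ContDiffOn ℝ 2 (feature H) (nonzeroBlocks P d))
    (f : H) (A : SphProd P d) (u v : Amb P d) :
    fderiv ℝ (fderiv ℝ fun z => inner ℝ f (feature H z)) (embed A) u v =
      inner ℝ f (fderiv ℝ (fderiv ℝ (feature H)) (embed A) u v) := by
  have hd : DifferentiableAt ℝ (fderiv ℝ (feature H)) (embed A) :=
    ((contDiffAt_feature hΦ A).fderiv_right (m := 1) (by norm_num)).differentiableAt (by norm_num)
  have hd' : DifferentiableAt ℝ (fderiv ℝ fun z => inner ℝ f (feature H z)) (embed A) :=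
    ((contDiffAt_inner_feature hΦ f A).fderiv_right (m := 1)
      (by norm_num)).differentiableAt (by norm_num)
  have h1 := hd'.hasFDerivAt.clm_apply (hasFDerivAt_const v (embed A))
  have h2 := ((innerSL ℝ f).hasFDerivAt.comp (embed A)
    (hd.hasFDerivAt.clm_apply (hasFDerivAt_const v (embed A))))
  have h3 : (fun z => fderiv ℝ (fun z => inner ℝ f (feature H z)) z v) =ᶠ[nhds (embed A)]
      (innerSL ℝ f) ∘ fun z => fderiv ℝ (feature H) z v := by
    filter_upwards [isOpen_nonzeroBlocks.mem_nhds (embed_mem_nonzeroBlocks A)] with z hz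
    exact fderiv_inner_feature hΦ f hz v
  have h4 := DFunLike.congr_fun (h1.unique (h2.congr_of_eventuallyEq h3)) u
  simpa using h4

/-- On the reproducing kernel Hilbert space the generator is represented by its action on the
feature map. -/
lemma generator_eq_inner (hΦ : ContDiffOn ℝ 2 (feature H) (nonzeroBlocks P d))
    {h : SphProd P d → ℝ} {he : Amb P d → ℝ}
    (hh : ∀ A, he (embed A) = h A) (hd : ∀ A : SphProd P d, DifferentiableAt ℝ he (embed A))
    (f : H) (A : SphProd P d) :
    act (grad f) h A + beltrami f A = inner ℝ f (generatorFeature H he A) := by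
  have hf : ∀ A, inner ℝ f (feature H (embed A)) = f A := fun A => by
    rw [inner_feature, retract_embed]
  rw [generator_eq hf (contDiffAt_inner_feature hΦ f) hh A (hd A), generatorFeature]
  simp only [fderiv_inner_feature hΦ f (embed_mem_nonzeroBlocks A), fderiv_fderiv_inner_feature hΦ,
    inner_add_right, inner_sum, inner_sub_right]

/-- Exhibits `f ↦ grad f A` as linear and continuous on `H`, whence the kernel of `grad` is a closed
subspace. -/
lemma grad_eq_sum_inner (hΦ : ContDiffOn ℝ 2 (feature H) (nonzeroBlocks P d))
    (f : H) (A : SphProd P d) :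
    grad f A = ∑ j, inner ℝ f (fderiv ℝ (feature H) (embed A) (basisVec A 0 j)) •
      basisVec A 0 j := by
  have hf : ∀ A, inner ℝ f (feature H (embed A)) = f A := fun A => by
    rw [inner_feature, retract_embed]
  rw [grad_eq_tangentPart hf A ((contDiffAt_inner_feature hΦ f A).differentiableAt (by norm_num)),
    ← sum_inner_basisVec]
  simp only [inner_gradient_right, fderiv_inner_feature hΦ f (embed_mem_nonzeroBlocks A)]

lemma continuous_drift {he : Amb P d → ℝ} (hs : ∀ A : SphProd P d, ContDiffAt ℝ 1 he (embed A)) :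
    Continuous (drift he) := by
  have h1 : Continuous fun A : SphProd P d => ∇ he (embed A) := by
    refine (InnerProductSpace.toDual ℝ (Amb P d)).symm.continuous.comp ?_
    rw [continuous_iff_continuousAt]
    intro A
    exact ((hs A).fderiv_right (m := 0) (by norm_num)).continuousAt.comp
      continuous_embed.continuousAt
  unfold drift tangentPart
  refine Continuous.sub ?_ ((continuous_const_smul (d : ℝ)).comp continuous_embed)
  refine (PiLp.continuous_toLp 2 _).comp (continuous_pi fun k => ?_)
  have h2 : Continuous fun A : SphProd P d => (∇ he (embed A)) k := by fun_prop
  have h3 : Continuous fun A : SphProd P d => (A k : EuclideanSpace ℝ (Fin (d + 1))) := by fun_prop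
  exact h2.sub ((h3.inner h2).fun_smul h3)

lemma continuous_generatorFeature (hΦ : ContDiffOn ℝ 2 (feature H) (nonzeroBlocks P d))
    {he : Amb P d → ℝ}
    (hs : ∀ A : SphProd P d, ContDiffAt ℝ 1 he (embed A)) :
    Continuous (generatorFeature H he) := by
  have h1 : Continuous fun A : SphProd P d => fderiv ℝ (feature H) (embed A) := by
    rw [continuous_iff_continuousAt]
    intro A
    exact ((contDiffAt_feature hΦ A).fderiv_right (m := 1) (by norm_num)).continuousAt.comp
      continuous_embed.continuousAt
  have h2 : Continuous fun A : SphProd P d => fderiv ℝ (fderiv ℝ (feature H)) (embed A) := by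
    rw [continuous_iff_continuousAt]
    intro A
    exact (((contDiffAt_feature hΦ A).fderiv_right (m := 1) (by norm_num)).fderiv_right (m := 0)
      (by norm_num)).continuousAt.comp continuous_embed.continuousAt
  have h3 : ∀ k, Continuous fun A : SphProd P d =>
      incl k (A k : EuclideanSpace ℝ (Fin (d + 1))) := fun k => by fun_prop
  unfold generatorFeature
  refine (h1.clm_apply (continuous_drift hs)).add (continuous_finsetSum _ fun k _ => ?_)
  refine (continuous_finsetSum _ fun i _ => ?_).sub ((h2.clm_apply (h3 k)).clm_apply (h3 k))
  exact (h2.clm_apply continuous_const).clm_apply continuous_const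

end FeatureMap

/-! ### Maximizing a linear functional in the quotient norm. -/

section Variational

variable {H : Type*} [NormedAddCommGroup H] [InnerProductSpace ℝ H]

/-- A function attains its quotient norm modulo a closed subspace `N` at its projection to the
orthogonal complement of `N`. -/
lemma isLeast_norm_coset (N : Submodule ℝ H) [N.HasOrthogonalProjection] (f : H) :
    IsLeast {r : ℝ | ∃ f' : H, f - f' ∈ N ∧ r = ‖f'‖} ‖f - N.starProjection f‖ := by
  refine ⟨⟨f - N.starProjection f, by simp, rfl⟩, ?_⟩
  rintro r ⟨f', hf', rfl⟩
  have h1 : f - N.starProjection f = f' - N.starProjection f' := by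
    have h2 : N.starProjection (f - f') = f - f' := Submodule.starProjection_eq_self_iff.2 hf'
    rw [map_sub] at h2
    rw [sub_eq_sub_iff_sub_eq_sub, ← h2]
  rw [h1, ← Submodule.starProjection_orthogonal_val]
  exact (Nᗮ).norm_starProjection_apply_le f'

variable [CompleteSpace H] [RKHS ℝ H (SphProd P d) ℝ]

/-- If `𝒥` is represented by `g` on the Hilbert space, then `grad g` is the functional gradient. -/
theorem isFunctionalGradient_of_inner {q : Measure (SphProd P d)} {p : SphProd P d → ℝ} {g : H}
    (G : H →ₗ[ℝ] SphProd P d → Amb P d) (hG : ∀ f : H, G f = grad f)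
    (hclosed : IsClosed (LinearMap.ker G : Set H))
    (hobj : ∀ f : H, objective q p (grad f) = inner ℝ f g) :
    IsFunctionalGradient H q p (grad g) := by
  set N := LinearMap.ker G with hN
  have : CompleteSpace N := hclosed.completeSpace_coe
  -- `Q f` is the representative of least norm of the coset `f + N`.
  set Q : H → H := fun f => f - N.starProjection f with hQ
  have hobj' : ∀ f : H, objective q p (G f) = inner ℝ f g := fun f => by rw [hG, hobj]
  have hnorm : ∀ f : H, gradNorm H (G f) = ‖Q f‖ := by
    intro f
    rw [gradNorm, ← (isLeast_norm_coset N f).csInf_eq]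
    congr 1
    ext r
    simp only [Set.mem_ofPred_eq, ← hG, hN, LinearMap.mem_ker, map_sub, sub_eq_zero]
  have hmem : ∀ f : H, G f ∈ gradFields (P := P) (d := d) H := fun f => ⟨f, hG f⟩
  have hQG : ∀ f, G (Q f) = G f := by
    intro f
    have h1 : N.starProjection f ∈ N := Submodule.starProjection_apply_mem _ _
    rw [hQ]
    simp only [map_sub]
    rw [LinearMap.mem_ker.1 h1, sub_zero]
  have hinner : ∀ f, inner ℝ (Q f) g = inner ℝ f g := fun f => by
    rw [← hobj', ← hobj', hQG]
  -- For `u ∈ N`, `⟨u, g⟩ = 𝒥(G u) = 𝒥(0) = 0`, so `g` is already orthogonal to `N`.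
  have hg : Q g = g := by
    have h1 : N.starProjection g = 0 := by
      rw [Submodule.starProjection_apply_eq_zero_iff, Submodule.mem_orthogonal]
      intro u hu
      rw [← hobj', LinearMap.mem_ker.1 hu, ← map_zero G, hobj', inner_zero_left]
    simp [hQ, h1]
  have hQsmul : ∀ (c : ℝ), Q (c • g) = c • g := fun c => by
    have : Q (c • g) = c • Q g := by simp [hQ, smul_sub]
    rw [this, hg]
  rw [← hG]
  refine ⟨hmem g, ?_, ?_⟩
  · rintro ⟨X, hX, hX1⟩
    -- If `g = 0`, the objective vanishes identically and any unit vector is a maximizer.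
    by_cases hg0 : g = 0
    · refine ⟨X, hX, hX1, ?_⟩
      obtain ⟨f, rfl⟩ := hX
      rintro Y ⟨f', rfl⟩ -
      rw [hobj, hobj, hg0, inner_zero_right, inner_zero_right]
    · have hg1 : ‖g‖ ≠ 0 := norm_ne_zero_iff.2 hg0
      refine ⟨G (‖g‖⁻¹ • g), hmem _, ?_, ?_⟩
      · rw [hnorm, hQsmul, norm_smul, norm_inv, norm_norm, inv_mul_cancel₀ hg1]
      · rintro Y ⟨f', rfl⟩ hY
        rw [← hG, hnorm] at hY
        rw [hobj, hobj', ← hinner f', inner_smul_left, real_inner_self_eq_norm_sq]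
        refine (real_inner_le_norm _ _).trans (le_of_eq ?_)
        rw [hY, conj_trivial]
        field_simp
  · rintro X₀ ⟨⟨f, rfl⟩, hf1, hmax⟩
    rw [← hG] at hf1 hmax ⊢
    rw [hnorm] at hf1
    rw [hobj']
    by_cases hg0 : g = 0
    · rw [hg0, inner_zero_right, zero_smul, map_zero]
    · have hg1 : ‖g‖ ≠ 0 := norm_ne_zero_iff.2 hg0
      have h1 := hmax (G (‖g‖⁻¹ • g)) (hmem _) (by
        rw [hnorm, hQsmul, norm_smul, norm_inv, norm_norm, inv_mul_cancel₀ hg1])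
      rw [hobj', hobj', inner_smul_left, real_inner_self_eq_norm_sq, conj_trivial,
        ← hinner f] at h1
      -- Comparison with `g / ‖g‖` forces equality in Cauchy–Schwarz for the unit vector `Q f`, so
      -- `‖g‖ • Q f = g`.
      have h2 : inner ℝ (Q f) g = ‖g‖ := by
        refine le_antisymm ?_ (le_trans (le_of_eq ?_) h1)
        · simpa [hf1] using real_inner_le_norm (Q f) g
        · field_simp
      have h3 : ‖g‖ • Q f = ‖Q f‖ • g :=
        inner_eq_norm_mul_iff_real.1 (by rw [h2, hf1, one_mul])
      rw [← hinner f, h2, ← hQG f, ← map_smul, h3, hf1, one_smul]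

end Variational

/-! ### The objective as an inner product, and identification of `f̂`. -/

section Objective

variable {H : Type*} [NormedAddCommGroup H] [InnerProductSpace ℝ H] [CompleteSpace H]
  [RKHS ℝ H (SphProd P d) ℝ] {K : SphProd P d → SphProd P d → ℝ}
  {q : Measure (SphProd P d)} [IsProbabilityMeasure q] {p : SphProd P d → ℝ} {he : Amb P d → ℝ}

lemma integrable_generatorFeature (hΦ : ContDiffOn ℝ 2 (feature H) (nonzeroBlocks P d))
    (hs : ∀ A : SphProd P d, ContDiffAt ℝ 1 he (embed A)) :
    Integrable (generatorFeature H he) q :=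
  (continuous_generatorFeature hΦ hs).integrable_of_hasCompactSupport
    (HasCompactSupport.of_compactSpace _)

/-- `X̂` is the functional gradient, for a reproducing kernel Hilbert space with `C²` feature
map. -/
theorem isFunctionalGradient_Xhat (hH : ∀ A B, RKHS.kernel H A B 1 = K A B)
    (hΦ : ContDiffOn ℝ 2 (feature H) (nonzeroBlocks P d))
    (hh : ∀ A, he (embed A) = Real.log (p A))
    (hs : ∀ A : SphProd P d, ContDiffAt ℝ 1 he (embed A)) :
    IsFunctionalGradient H q p (Xhat q p K) ∧ ∀ B, Integrable (fhatIntegrand p K B) q := by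
  have hgen := generator_eq_inner hΦ hh (fun A => (hs A).differentiableAt (by norm_num))
  have hint := integrable_generatorFeature (q := q) hΦ hs
  have hobj : ∀ f : H, objective q p (grad f) = inner ℝ f (∫ A, generatorFeature H he A ∂q) := by
    intro f
    rw [objective, ← integral_inner hint]
    exact integral_congr_ae (Filter.Eventually.of_forall fun A => hgen f A)
  have hker : ∀ B, (fun C => K C B) = ⇑(RKHS.kerFun H B (1 : ℝ)) := by
    intro B
    funext C
    rw [RKHS.kerFun_apply, hH]
  have hfi : ∀ B A, fhatIntegrand p K B A =
      inner ℝ (RKHS.kerFun H B (1 : ℝ)) (generatorFeature H he A) := by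
    intro B A
    rw [fhatIntegrand, hker, hgen]
  -- Pairing the Bochner integral with the kernel section at `B` evaluates it at `B`, so `f̂` is the
  -- function of the representing vector.
  have hfhat : fhat q p K = ⇑(∫ A, generatorFeature H he A ∂q) := by
    funext B
    rw [fhat]
    simp only [hfi]
    rw [integral_inner hint, RKHS.kerFun_inner]
    simp
  refine ⟨?_, fun B => ?_⟩
  · let G : H →ₗ[ℝ] SphProd P d → Amb P d :=
      { toFun := fun f => grad f
        map_add' := fun f f' => by
          funext A
          simp only [Pi.add_apply, grad_eq_sum_inner hΦ, inner_add_left, add_smul,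
            Finset.sum_add_distrib]
        map_smul' := fun c f => by
          funext A
          simp only [Pi.smul_apply, grad_eq_sum_inner hΦ, inner_smul_left, mul_smul,
            Finset.smul_sum, RingHom.id_apply, conj_trivial] }
    have hcl : IsClosed (LinearMap.ker G : Set H) := by
      have : Continuous G := by
        refine continuous_pi fun A => ?_
        change Continuous fun f : H => grad f A
        simp only [grad_eq_sum_inner hΦ]
        fun_prop
      exact isClosed_singleton.preimage this
    rw [Xhat, hfhat]
    exact isFunctionalGradient_of_inner G (fun _ => rfl) hcl hobj
  · have : fhatIntegrand p K B = fun A =>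
        inner ℝ (RKHS.kerFun H B (1 : ℝ)) (generatorFeature H he A) := funext (hfi B)
    rw [this]
    exact hint.const_inner _

end Objective

/-! ### Derivatives of exponentials of block sums, and the embedded summand. -/

section Calculus

variable {V : Type*} [NormedAddCommGroup V] [NormedSpace ℝ V]

lemma fderiv_of_eventuallyEq_exp {g S : V → ℝ} {x : V} (hS : DifferentiableAt ℝ S x)
    (hg : g =ᶠ[nhds x] fun y => Real.exp (S y)) : fderiv ℝ g x = g x • fderiv ℝ S x := by
  rw [hg.fderiv_eq, hg.eq_of_nhds]
  exact hS.hasFDerivAt.exp.fderiv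

/-- The rank-one term `DS ⊗ DS` is the source of `‖∇ L‖²` and `(yᵀ ∇ L)²` in the embedded
expression. -/
lemma fderiv_fderiv_of_eventuallyEq_exp {g S : V → ℝ} {x : V} (hS : ContDiffAt ℝ 2 S x)
    (hg : g =ᶠ[nhds x] fun y => Real.exp (S y)) (u v : V) :
    fderiv ℝ (fderiv ℝ g) x u v =
      g x * (fderiv ℝ (fderiv ℝ S) x u v + fderiv ℝ S x u * fderiv ℝ S x v) := by
  have h1 : fderiv ℝ g =ᶠ[nhds x] fun y => g y • fderiv ℝ S y := by
    filter_upwards [hS.eventually (by simp), hg.eventuallyEq_nhds] with y hy hgy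
    exact fderiv_of_eventuallyEq_exp (hy.differentiableAt (by norm_num)) hgy
  have hgd : DifferentiableAt ℝ g x :=
    ((hS.differentiableAt (by norm_num)).exp).congr_of_eventuallyEq hg
  have hSd : DifferentiableAt ℝ (fderiv ℝ S) x :=
    (hS.fderiv_right (m := 1) (by norm_num)).differentiableAt (by norm_num)
  have h2 := hgd.hasFDerivAt.smul hSd.hasFDerivAt
  have h3 : fderiv ℝ (fderiv ℝ g) x = _ := (h2.congr_of_eventuallyEq h1).fderiv
  rw [h3, fderiv_of_eventuallyEq_exp (hS.differentiableAt (by norm_num)) hg]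
  simp
  ring

end Calculus

/-- The projection of the embedding space onto its `k`-th block. -/
def blockProj (k : Fin P) : Amb P d →L[ℝ] EuclideanSpace ℝ (Fin (d + 1)) :=
  PiLp.proj 2 (fun _ : Fin P => EuclideanSpace ℝ (Fin (d + 1))) k

lemma blockProj_apply (k : Fin P) (v : Amb P d) : blockProj k v = v k := rfl

lemma hasFDerivAt_sum_blocks {L : Fin P → EuclideanSpace ℝ (Fin (d + 1)) → ℝ} {x : Amb P d}
    (hL : ∀ k, DifferentiableAt ℝ (L k) (x k)) :
    HasFDerivAt (fun w : Amb P d => ∑ k, L k (w k))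
      (∑ k, fderiv ℝ (L k) (x k) ∘L blockProj k) x :=
  HasFDerivAt.fun_sum fun k _ =>
    HasFDerivAt.comp x (f := fun w : Amb P d => w k) (hL k).hasFDerivAt (blockProj k).hasFDerivAt

lemma fderiv_sum_blocks_apply {L : Fin P → EuclideanSpace ℝ (Fin (d + 1)) → ℝ} {x : Amb P d}
    (hL : ∀ k, DifferentiableAt ℝ (L k) (x k)) (v : Amb P d) :
    fderiv ℝ (fun w : Amb P d => ∑ k, L k (w k)) x v = ∑ k, fderiv ℝ (L k) (x k) (v k) := by
  rw [(hasFDerivAt_sum_blocks hL).fderiv]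
  simp [blockProj_apply]

lemma contDiffAt_sum_blocks {L : Fin P → EuclideanSpace ℝ (Fin (d + 1)) → ℝ} {x : Amb P d}
    {n : WithTop ℕ∞} (hL : ∀ k, ContDiffAt ℝ n (L k) (x k)) :
    ContDiffAt ℝ n (fun w : Amb P d => ∑ k, L k (w k)) x :=
  ContDiffAt.sum fun k _ =>
    ContDiffAt.comp x (f := fun w : Amb P d => w k) (hL k) (contDiff_block k).contDiffAt

/-- The Hessian is block diagonal: each summand depends on one block only. -/
lemma fderiv_fderiv_sum_blocks {L : Fin P → EuclideanSpace ℝ (Fin (d + 1)) → ℝ} {x : Amb P d}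
    (hL : ∀ k, ContDiffAt ℝ 2 (L k) (x k)) (u v : Amb P d) :
    fderiv ℝ (fderiv ℝ fun w : Amb P d => ∑ k, L k (w k)) x u v =
      ∑ k, fderiv ℝ (fderiv ℝ (L k)) (x k) (u k) (v k) := by
  have hS : DifferentiableAt ℝ (fderiv ℝ fun w : Amb P d => ∑ k, L k (w k)) x :=
    ((contDiffAt_sum_blocks hL).fderiv_right (m := 1) (by norm_num)).differentiableAt (by norm_num)
  have hb : ∀ k, ContinuousAt (fun w : Amb P d => w k) x := fun k =>
    (contDiff_block k (n := 0)).continuous.continuousAt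
  have h1 : (fun w => fderiv ℝ (fun w : Amb P d => ∑ k, L k (w k)) w v) =ᶠ[nhds x]
      fun w => ∑ k, fderiv ℝ (L k) (w k) (v k) := by
    have h2 : ∀ᶠ w in nhds x, ∀ k, ContDiffAt ℝ 2 (L k) (w k) :=
      Filter.eventually_all.2 fun k => (hb k).eventually ((hL k).eventually (by simp))
    filter_upwards [h2] with w hw
    exact fderiv_sum_blocks_apply (fun k => (hw k).differentiableAt (by norm_num)) v
  have h3 : HasFDerivAt (fun w : Amb P d => ∑ k, fderiv ℝ (L k) (w k) (v k))
      (∑ k, (fderiv ℝ (fderiv ℝ (L k)) (x k) ∘L blockProj k).flip (v k)) x := by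
    refine HasFDerivAt.fun_sum fun k _ => ?_
    have hd : DifferentiableAt ℝ (fderiv ℝ (L k)) (x k) :=
      ((hL k).fderiv_right (m := 1) (by norm_num)).differentiableAt (by norm_num)
    have h4 := (HasFDerivAt.comp x (f := fun w : Amb P d => w k) hd.hasFDerivAt
      (blockProj k).hasFDerivAt).clm_apply (hasFDerivAt_const (v k) x)
    exact h4.congr_fderiv (by simp)
  have h5 := hS.hasFDerivAt.clm_apply (hasFDerivAt_const v x)
  have h6 := DFunLike.congr_fun (h5.unique (h3.congr_of_eventuallyEq h1)) u
  simpa [blockProj_apply] using h6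

lemma gradient_eq_sum {V ι : Type*} [NormedAddCommGroup V] [InnerProductSpace ℝ V]
    [CompleteSpace V] [Fintype ι] (b : OrthonormalBasis ι ℝ V) (g : V → ℝ) (x : V) :
    ∇ g x = ∑ i, fderiv ℝ g x (b i) • b i := by
  rw [← b.sum_repr' (∇ g x)]
  simp only [inner_gradient_right]

lemma hessQuad_eq {L : EuclideanSpace ℝ (Fin (d + 1)) → ℝ} {y : EuclideanSpace ℝ (Fin (d + 1))}
    (hL : DifferentiableAt ℝ (fderiv ℝ L) y) :
    hessQuad L y = fderiv ℝ (fderiv ℝ L) y y y := by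
  have h1 : ∇ L = fun y => ∑ i, fderiv ℝ L y (EuclideanSpace.basisFun (Fin (d + 1)) ℝ i) •
      EuclideanSpace.basisFun (Fin (d + 1)) ℝ i :=
    funext fun y => gradient_eq_sum _ L y
  have hd : DifferentiableAt ℝ (∇ L) y := by
    rw [h1]
    fun_prop
  have h2 := (innerSL ℝ y).hasFDerivAt.comp y hd.hasFDerivAt
  have h3 : (innerSL ℝ y) ∘ (∇ L) = fun x => fderiv ℝ L x y := by
    funext x
    simp
  rw [h3] at h2
  have h4 := hL.hasFDerivAt.clm_apply (hasFDerivAt_const y y)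
  have h5 := DFunLike.congr_fun (h2.unique h4) y
  rw [hessQuad]
  simpa using h5

lemma laplacian_eq_sum (L : EuclideanSpace ℝ (Fin (d + 1)) → ℝ)
    (y : EuclideanSpace ℝ (Fin (d + 1))) :
    Laplacian.laplacian L y = ∑ i, fderiv ℝ (fderiv ℝ L) y
      (EuclideanSpace.basisFun (Fin (d + 1)) ℝ i) (EuclideanSpace.basisFun (Fin (d + 1)) ℝ i) := by
  rw [InnerProductSpace.laplacian_eq_iteratedFDeriv_orthonormalBasis L
    (EuclideanSpace.basisFun (Fin (d + 1)) ℝ)]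
  simp [iteratedFDeriv_two_apply]

/-- The embedded summand in terms of derivatives in the coordinate directions. -/
def coordSummand (he : Amb P d → ℝ) (x : Amb P d) (k : Fin P)
    (L : EuclideanSpace ℝ (Fin (d + 1)) → ℝ) (y : EuclideanSpace ℝ (Fin (d + 1))) : ℝ :=
  ∑ i, fderiv ℝ he x (incl k (EuclideanSpace.basisFun (Fin (d + 1)) ℝ i)) *
      fderiv ℝ L y (EuclideanSpace.basisFun (Fin (d + 1)) ℝ i) +
    ∑ i, fderiv ℝ (fderiv ℝ L) y (EuclideanSpace.basisFun (Fin (d + 1)) ℝ i)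
      (EuclideanSpace.basisFun (Fin (d + 1)) ℝ i) -
    fderiv ℝ (fderiv ℝ L) y y y +
    ∑ i, fderiv ℝ L y (EuclideanSpace.basisFun (Fin (d + 1)) ℝ i) ^ 2 -
    fderiv ℝ L y y ^ 2 - (fderiv ℝ he x (incl k y) + d) * fderiv ℝ L y y

lemma embSummand_eq (he : Amb P d → ℝ) (x : Amb P d) (k : Fin P)
    {L : EuclideanSpace ℝ (Fin (d + 1)) → ℝ} {y : EuclideanSpace ℝ (Fin (d + 1))}
    (hL : DifferentiableAt ℝ (fderiv ℝ L) y) :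
    embSummand ((∇ he x) k) L y = coordSummand he x k L y := by
  have h1 : ∀ v, inner ℝ ((∇ he x) k) v = fderiv ℝ he x (incl k v) := fun v => by
    rw [← inner_incl_right, inner_gradient_left]
  have h2 : inner ℝ ((∇ he x) k) (∇ L y) =
      ∑ i, fderiv ℝ he x (incl k (EuclideanSpace.basisFun (Fin (d + 1)) ℝ i)) *
        fderiv ℝ L y (EuclideanSpace.basisFun (Fin (d + 1)) ℝ i) := by
    rw [gradient_eq_sum (EuclideanSpace.basisFun (Fin (d + 1)) ℝ) L, inner_sum]
    refine Finset.sum_congr rfl fun i _ => ?_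
    rw [inner_smul_right, h1, mul_comm]
  have h3 : ‖∇ L y‖ ^ 2 = ∑ i, fderiv ℝ L y (EuclideanSpace.basisFun (Fin (d + 1)) ℝ i) ^ 2 := by
    rw [← (EuclideanSpace.basisFun (Fin (d + 1)) ℝ).sum_sq_norm_inner_right]
    simp only [inner_gradient_right, Real.norm_eq_abs, sq_abs]
  rw [embSummand, coordSummand, h2, h3, laplacian_eq_sum, hessQuad_eq hL, inner_gradient_right,
    real_inner_comm ((∇ he x) k) y, h1]
  push_cast
  ring

/-- The generator applied to an exponential of a sum of functions of the blocks. -/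
lemma generator_exp_sum {f h : SphProd P d → ℝ} {fe he : Amb P d → ℝ}
    {L : Fin P → EuclideanSpace ℝ (Fin (d + 1)) → ℝ}
    (hf : ∀ A, fe (embed A) = f A) (hs : ∀ A : SphProd P d, ContDiffAt ℝ 2 fe (embed A))
    (hh : ∀ A, he (embed A) = h A) (A : SphProd P d) (hd : DifferentiableAt ℝ he (embed A))
    (hL : ∀ k, ContDiffAt ℝ 2 (L k) (A k))
    (hexp : fe =ᶠ[nhds (embed A)] fun w => Real.exp (∑ k, L k (w k))) :
    act (grad f) h A + beltrami f A =
      f A * ∑ k, embSummand ((∇ he (embed A)) k) (L k) (A k) := by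
  have hLd : ∀ k, DifferentiableAt ℝ (L k) (embed A k) := fun k =>
    (hL k).differentiableAt (by norm_num)
  have hS : ContDiffAt ℝ 2 (fun w : Amb P d => ∑ k, L k (w k)) (embed A) :=
    contDiffAt_sum_blocks hL
  have h1 : ∀ (g : Fin P → EuclideanSpace ℝ (Fin (d + 1)) → ℝ) (k : Fin P)
      (u : EuclideanSpace ℝ (Fin (d + 1))), (∀ m, g m 0 = 0) →
      ∑ m, g m (incl (P := P) k u m) = g k u := by
    intro g k u hg
    rw [Finset.sum_eq_single k]
    · simp [incl_apply]
    · intro m _ hm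
      simp [incl_apply, hm, hg]
    · simp
  have h2 : ∀ k u, fderiv ℝ (fun w : Amb P d => ∑ k, L k (w k)) (embed A) (incl k u) =
      fderiv ℝ (L k) (A k) u := by
    intro k u
    rw [fderiv_sum_blocks_apply hLd]
    exact h1 (fun m v => fderiv ℝ (L m) (A m) v) k u (by simp)
  have h3 : ∀ k u, fderiv ℝ (fderiv ℝ fe) (embed A) (incl k u) (incl k u) =
      f A * (fderiv ℝ (fderiv ℝ (L k)) (A k) u u + fderiv ℝ (L k) (A k) u ^ 2) := by
    intro k u
    rw [fderiv_fderiv_of_eventuallyEq_exp hS hexp, hf, h2, fderiv_fderiv_sum_blocks hL, sq]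
    congr 2
    exact h1 (fun m v => fderiv ℝ (fderiv ℝ (L m)) (A m) v v) k u (by simp)
  rw [generator_eq hf hs hh A hd, Finset.mul_sum]
  have h4 : fderiv ℝ fe (embed A) (drift he A) =
      ∑ k, f A * fderiv ℝ (L k) (A k) (drift he A k) := by
    rw [fderiv_of_eventuallyEq_exp (hS.differentiableAt (by norm_num)) hexp, hf, smul_apply,
      fderiv_sum_blocks_apply hLd, smul_eq_mul, Finset.mul_sum]
    rfl
  rw [h4, ← Finset.sum_add_distrib]
  refine Finset.sum_congr rfl fun k _ => ?_
  have hLd2 : DifferentiableAt ℝ (fderiv ℝ (L k)) (A k) :=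
    ((hL k).fderiv_right (m := 1) (by norm_num)).differentiableAt (by norm_num)
  have h5 : ∀ v, inner ℝ ((∇ he (embed A)) k) v = fderiv ℝ he (embed A) (incl k v) := fun v => by
    rw [← inner_incl_right, inner_gradient_left]
  -- The normal part removed from `∇ he` and the curvature term `-d A₍ₖ₎` combine into one multiple
  -- of the normal derivative of `L k`.
  have h6 : fderiv ℝ (L k) (A k) (drift he A k) =
      ∑ i, fderiv ℝ he (embed A) (incl k (EuclideanSpace.basisFun (Fin (d + 1)) ℝ i)) *
        fderiv ℝ (L k) (A k) (EuclideanSpace.basisFun (Fin (d + 1)) ℝ i) -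
      (fderiv ℝ he (embed A) (incl k (A k)) + d) * fderiv ℝ (L k) (A k) (A k) := by
    have h7 : drift he A k = (∇ he (embed A)) k -
        inner ℝ (A k : EuclideanSpace ℝ (Fin (d + 1))) ((∇ he (embed A)) k) •
        (A k : EuclideanSpace ℝ (Fin (d + 1))) -
        (d : ℝ) • (A k : EuclideanSpace ℝ (Fin (d + 1))) := rfl
    have h8 := (EuclideanSpace.basisFun (Fin (d + 1)) ℝ).sum_repr' ((∇ he (embed A)) k)
    rw [h7, map_sub, map_sub, map_smul, map_smul, real_inner_comm, h5, ← h8, map_sum]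
    simp only [map_smul, smul_eq_mul, real_inner_comm _ (EuclideanSpace.basisFun _ ℝ _), h5]
    ring
  rw [embSummand_eq he (embed A) k hLd2, coordSummand, h6]
  simp only [h3, ← Finset.mul_sum, Finset.sum_add_distrib]
  ring

/-! ### Integrals depending on a parameter. -/

section ParametricIntegral

variable {V W G : Type*} [NormedAddCommGroup V] [NormedSpace ℝ V] [NormedAddCommGroup W]
  [NormedSpace ℝ W] [NormedAddCommGroup G] [NormedSpace ℝ G]

/-- Partial derivatives of a smooth function are smooth. -/
lemma contDiffAt_partial_fderiv {ℓ : V × W → G} {w : V × W} {m n : WithTop ℕ∞}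
    (h : ContDiffAt ℝ n ℓ w) (hmn : m + 1 ≤ n) :
    ContDiffAt ℝ m (fun w : V × W => fderiv ℝ (fun y => ℓ (y, w.2)) w.1) w := by
  refine ContDiffAt.fderiv (f := fun (w : V × W) y => ℓ (y, w.2)) (n := n) ?_ contDiffAt_fst hmn
  have h1 : ContDiffAt ℝ n (fun p : (V × W) × V => (p.2, p.1.2)) (w, w.1) := by fun_prop
  exact ContDiffAt.comp (g := ℓ) (w, w.1) h h1

/-- Differentiability of an integral over a compact space depending `C¹` on a parameter. -/
lemma differentiableAt_integral_of_contDiffAt {X : Type*} [TopologicalSpace X] [CompactSpace X]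
    [MeasurableSpace X] [OpensMeasurableSpace X] [SecondCountableTopology X]
    {q : Measure X} [IsFiniteMeasure q] {e : X → V} (he : Continuous e)
    {F : V × W → ℝ} {z₀ : W} (hF : ∀ x, ContDiffAt ℝ 1 F (e x, z₀)) :
    DifferentiableAt ℝ (fun z => ∫ x, F (e x, z) ∂q) z₀ := by
  have hpair : Continuous fun p : W × X => (e p.2, p.1) := by fun_prop
  have hD : ∀ x, ContinuousAt (fderiv ℝ F) (e x, z₀) := fun x =>
    ((hF x).fderiv_right (m := 0) (by norm_num)).continuousAt
  have hDc : Continuous fun x => fderiv ℝ F (e x, z₀) := by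
    rw [continuous_iff_continuousAt]
    intro x
    exact ContinuousAt.comp (f := fun x => (e x, z₀)) (hD x) (by fun_prop)
  obtain ⟨C, hC⟩ := isCompact_univ.exists_bound_of_continuousOn hDc.continuousOn
  -- Regularity is known only at `z₀`, but it and the derivative bound are open conditions in `(x,
  -- z)`; compactness of `X` gives one neighbourhood of `z₀` valid for all `x`, and hence a constant
  -- dominating function.
  have hev : ∀ᶠ z in nhds z₀, ∀ x ∈ (Set.univ : Set X),
      ContDiffAt ℝ 1 F (e x, z) ∧ ‖fderiv ℝ F (e x, z)‖ < C + 1 := by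
    apply isCompact_univ.eventually_forall_of_forall_eventually
      (P := fun z x => ContDiffAt ℝ 1 F (e x, z) ∧ ‖fderiv ℝ F (e x, z)‖ < C + 1)
    intro x _
    refine Filter.Eventually.and ?_ ?_
    · exact (hpair.continuousAt (x := (z₀, x))).eventually ((hF x).eventually (by simp))
    · have h1 : ContinuousAt (fun p : W × X => ‖fderiv ℝ F (e p.2, p.1)‖) (z₀, x) :=
        (ContinuousAt.comp (f := fun p : W × X => (e p.2, p.1)) (x := (z₀, x)) (hD x)
          hpair.continuousAt).norm
      exact h1.eventually_lt continuousAt_const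
        (lt_of_le_of_lt (hC x (Set.mem_univ x)) (lt_add_one C))
  have hcont : ∀ z, (∀ x, ContDiffAt ℝ 1 F (e x, z)) → Continuous fun x => F (e x, z) := by
    intro z hz
    rw [continuous_iff_continuousAt]
    intro x
    exact ContinuousAt.comp (f := fun x => (e x, z)) (hz x).continuousAt (by fun_prop)
  refine (hasFDerivAt_integral_of_dominated_of_fderiv_le (𝕜 := ℝ) (F := fun z x => F (e x, z))
    (F' := fun z x => fderiv ℝ F (e x, z) ∘L ContinuousLinearMap.inr ℝ V W)
    (bound := fun _ => C + 1) hev ?_ ?_ ?_ ?_ (integrable_const _) ?_).differentiableAt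
  · filter_upwards [hev] with z hz
    exact (hcont z fun x => (hz x (Set.mem_univ x)).1).aestronglyMeasurable
  · exact (hcont z₀ hF).integrable_of_hasCompactSupport (HasCompactSupport.of_compactSpace _)
  · exact (hDc.clm_comp continuous_const).aestronglyMeasurable
  · refine Filter.Eventually.of_forall fun x z hz => ?_
    refine (ContinuousLinearMap.opNorm_comp_le _ _).trans ?_
    have h1 := (hz x (Set.mem_univ x)).2.le
    have h2 := ContinuousLinearMap.norm_inr_le_one ℝ V W
    calc _ ≤ ‖fderiv ℝ F (e x, z)‖ * 1 := by gcongr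
      _ ≤ C + 1 := by rwa [mul_one]
  · refine Filter.Eventually.of_forall fun x z hz => ?_
    have h1 := ((hz x (Set.mem_univ x)).1.differentiableAt (by norm_num)).hasFDerivAt
    exact HasFDerivAt.comp z (f := fun z => (e x, z)) h1 (hasFDerivAt_prodMk_right (e x) z)

end ParametricIntegral

/-! ### The embedded integrand and its integral. -/

variable {κe : Fin P → EuclideanSpace ℝ (Fin (d + 1)) → EuclideanSpace ℝ (Fin (d + 1)) → ℝ}

/-- The embedded integrand as a function of two points of the embedding space. -/
def coordIntegrand (he : Amb P d → ℝ)
    (κe : Fin P → EuclideanSpace ℝ (Fin (d + 1)) → EuclideanSpace ℝ (Fin (d + 1)) → ℝ)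
    (w : Amb P d × Amb P d) : ℝ :=
  (∏ k, κe k (w.1 k) (w.2 k)) *
    ∑ k, coordSummand he w.1 k (fun y => Real.log (κe k y (w.2 k))) (w.1 k)

/-- Two derivatives fall on `log κe` and one on `he`, so `C³` and `C²` respectively leave a jointly
`C¹` integrand. -/
lemma contDiffAt_coordIntegrand {he : Amb P d → ℝ} {w : Amb P d × Amb P d}
    (hhe : ContDiffAt ℝ 2 he w.1) (hpos : ∀ k, 0 < κe k (w.1 k) (w.2 k))
    (hκe : ∀ k, ContDiffAt ℝ 3
      (fun w : EuclideanSpace ℝ (Fin (d + 1)) × EuclideanSpace ℝ (Fin (d + 1)) => κe k w.1 w.2)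
      (w.1 k, w.2 k)) :
    ContDiffAt ℝ 1 (coordIntegrand he κe) w := by
  have hb : ∀ k, ContDiffAt ℝ 3 (fun w : Amb P d × Amb P d => (w.1 k, w.2 k)) w := fun k =>
    ContDiffAt.prodMk ((contDiff_block k).contDiffAt.comp w contDiffAt_fst)
      ((contDiff_block k).contDiffAt.comp w contDiffAt_snd)
  have hy : ∀ k, ContDiffAt ℝ 1 (fun w : Amb P d × Amb P d => w.1 k) w := fun k =>
    (contDiff_block k).contDiffAt.comp w contDiffAt_fst
  have hℓ : ∀ k, ContDiffAt ℝ 3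
      (fun w : EuclideanSpace ℝ (Fin (d + 1)) × EuclideanSpace ℝ (Fin (d + 1)) =>
        Real.log (κe k w.1 w.2)) (w.1 k, w.2 k) := fun k => (hκe k).log (hpos k).ne'
  have hD1' := fun k => contDiffAt_partial_fderiv (m := 2) (hℓ k) (by norm_num)
  have hD2' := fun k => contDiffAt_partial_fderiv (m := 1) (hD1' k) (by norm_num)
  have hD1 : ∀ k, ContDiffAt ℝ 1 (fun w : Amb P d × Amb P d =>
      fderiv ℝ (fun y => Real.log (κe k y (w.2 k))) (w.1 k)) w := fun k =>
    ContDiffAt.comp w (f := fun w : Amb P d × Amb P d => (w.1 k, w.2 k))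
      ((hD1' k).of_le (by norm_num)) ((hb k).of_le (by norm_num))
  have hD2 : ∀ k, ContDiffAt ℝ 1 (fun w : Amb P d × Amb P d =>
      fderiv ℝ (fderiv ℝ (fun y => Real.log (κe k y (w.2 k)))) (w.1 k)) w := fun k =>
    ContDiffAt.comp w (f := fun w : Amb P d × Amb P d => (w.1 k, w.2 k))
      (hD2' k) ((hb k).of_le (by norm_num))
  have hDh : ContDiffAt ℝ 1 (fun w : Amb P d × Amb P d => fderiv ℝ he w.1) w :=
    ContDiffAt.comp w (hhe.fderiv_right (m := 1) (by norm_num)) contDiffAt_fst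
  have hin : ∀ k, ContDiffAt ℝ 1 (fun w : Amb P d × Amb P d => incl (P := P) k (w.1 k)) w :=
    fun k => (incl k).contDiff.contDiffAt.comp w (hy k)
  unfold coordIntegrand coordSummand
  refine ContDiffAt.mul ?_ ?_
  · exact contDiffAt_prod fun k _ => ContDiffAt.comp w
      (f := fun w : Amb P d × Amb P d => (w.1 k, w.2 k)) ((hκe k).of_le (by norm_num))
      ((hb k).of_le (by norm_num))
  · refine ContDiffAt.sum fun k _ => ?_
    have t1 := (hD1 k).clm_apply (hy k)
    have t2 := ((hD2 k).clm_apply (hy k)).clm_apply (hy k)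
    refine (((((ContDiffAt.sum fun i _ => ?_).add (ContDiffAt.sum fun i _ => ?_)).sub t2).add
      (ContDiffAt.sum fun i _ => ?_)).sub (t1.pow 2)).sub
      (((hDh.clm_apply (hin k)).add contDiffAt_const).mul t1)
    · exact (hDh.clm_apply contDiffAt_const).mul ((hD1 k).clm_apply contDiffAt_const)
    · exact ((hD2 k).clm_apply contDiffAt_const).clm_apply contDiffAt_const
    · exact ((hD1 k).clm_apply contDiffAt_const).pow 2

lemma embIntegrand_eq {pe : Amb P d → ℝ} {z : Amb P d} {A : SphProd P d}
    (hpos : ∀ k, 0 < κe k (A k) (z k))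
    (hκe : ∀ k, ContDiffAt ℝ 3
      (fun w : EuclideanSpace ℝ (Fin (d + 1)) × EuclideanSpace ℝ (Fin (d + 1)) => κe k w.1 w.2)
      ((A k : EuclideanSpace ℝ (Fin (d + 1))), z k)) :
    embIntegrand pe κe z A = coordIntegrand (fun w => Real.log (pe w)) κe (embed A, z) := by
  unfold embIntegrand coordIntegrand
  congr 1
  refine Finset.sum_congr rfl fun k _ => ?_
  have h1 : ContDiffAt ℝ 3 (fun y => Real.log (κe k y (z k))) (A k) := by
    refine ContDiffAt.log ?_ (hpos k).ne'
    exact ContDiffAt.comp (A k : EuclideanSpace ℝ (Fin (d + 1))) (f := fun y => (y, z k)) (hκe k)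
      (contDiffAt_id.prodMk contDiffAt_const)
  exact embSummand_eq _ _ _
    ((h1.fderiv_right (m := 2) (by norm_num)).differentiableAt (by norm_num))

lemma differentiableAt_embFhat {q : Measure (SphProd P d)} [IsProbabilityMeasure q]
    {pe : Amb P d → ℝ} (hpe : ∀ A : SphProd P d, ContDiffAt ℝ 2 pe (embed A))
    (hpe_pos : ∀ A : SphProd P d, 0 < pe (embed A))
    (hpos : ∀ k (a b : Sph d), 0 < κe k a b)
    (hκe : ∀ k (a b : Sph d), ContDiffAt ℝ 3
      (fun w : EuclideanSpace ℝ (Fin (d + 1)) × EuclideanSpace ℝ (Fin (d + 1)) => κe k w.1 w.2)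
      ((a : EuclideanSpace ℝ (Fin (d + 1))), (b : EuclideanSpace ℝ (Fin (d + 1)))))
    (B : SphProd P d) : DifferentiableAt ℝ (embFhat q pe κe) (embed B) := by
  have h1 : DifferentiableAt ℝ (fun z => ∫ A, coordIntegrand (fun w => Real.log (pe w)) κe
      (embed A, z) ∂q) (embed B) :=
    differentiableAt_integral_of_contDiffAt continuous_embed fun A =>
      contDiffAt_coordIntegrand ((hpe A).log (hpe_pos A).ne') (fun k => hpos k _ _)
        fun k => hκe k _ _
  refine h1.congr_of_eventuallyEq ?_
  -- The two integrands are compared also for `z` off the manifold; positivity and smoothness of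
  -- `κe` persist there, uniformly in `A` by compactness.
  have h2 : ∀ᶠ z in nhds (embed B), ∀ A ∈ (Set.univ : Set (SphProd P d)),
      ∀ k, 0 < κe k (A k) (z k) ∧ ContDiffAt ℝ 3
      (fun w : EuclideanSpace ℝ (Fin (d + 1)) × EuclideanSpace ℝ (Fin (d + 1)) => κe k w.1 w.2)
      ((A k : EuclideanSpace ℝ (Fin (d + 1))), z k) := by
    apply isCompact_univ.eventually_forall_of_forall_eventually (P := fun (z : Amb P d)
      (A : SphProd P d) => ∀ k, 0 < κe k (A k) (z k) ∧ ContDiffAt ℝ 3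
      (fun w : EuclideanSpace ℝ (Fin (d + 1)) × EuclideanSpace ℝ (Fin (d + 1)) => κe k w.1 w.2)
      ((A k : EuclideanSpace ℝ (Fin (d + 1))), z k))
    intro A _
    refine Filter.eventually_all.2 fun k => ?_
    have hc : ContinuousAt (fun p : Amb P d × SphProd P d =>
        ((p.2 k : EuclideanSpace ℝ (Fin (d + 1))), p.1 k)) (embed B, A) := by fun_prop
    have h3 : ∀ᶠ w in nhds ((A k : EuclideanSpace ℝ (Fin (d + 1))), embed B k),
        0 < κe k w.1 w.2 :=
      continuousAt_const.eventually_lt (hκe k (A k) (B k)).continuousAt (hpos k (A k) (B k))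
    exact hc.eventually (h3.and ((hκe k (A k) (B k)).eventually (by simp)))
  filter_upwards [h2] with z hz
  exact integral_congr_ae (Filter.Eventually.of_forall fun A =>
    embIntegrand_eq (fun k => (hz A (Set.mem_univ A) k).1) fun k => (hz A (Set.mem_univ A) k).2)

/-- The integrand of `f̂` is the integrand of the embedded expression. -/
lemma fhatIntegrand_eq_embIntegrand {κ : Fin P → Sph d → Sph d → ℝ} {p : SphProd P d → ℝ}
    {pe : Amb P d → ℝ} (hpe_eq : ∀ A, pe (embed A) = p A)
    (hpe : ∀ A : SphProd P d, DifferentiableAt ℝ pe (embed A))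
    (hpe_pos : ∀ A : SphProd P d, 0 < pe (embed A))
    (hκe_eq : ∀ k (a b : Sph d), κe k a b = κ k a b)
    (hpos : ∀ k (a b : Sph d), 0 < κe k a b)
    (hκe : ∀ k (a b : Sph d), ContDiffAt ℝ 2
      (fun w : EuclideanSpace ℝ (Fin (d + 1)) × EuclideanSpace ℝ (Fin (d + 1)) => κe k w.1 w.2)
      ((a : EuclideanSpace ℝ (Fin (d + 1))), (b : EuclideanSpace ℝ (Fin (d + 1)))))
    (B A : SphProd P d) :
    fhatIntegrand p (prodKernel κ) B A = embIntegrand pe κe (embed B) A := by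
  have hslice : ∀ k (a b : Sph d), ContDiffAt ℝ 2 (fun y => κe k y b) a := fun k a b =>
    ContDiffAt.comp (a : EuclideanSpace ℝ (Fin (d + 1)))
      (f := fun y => (y, (b : EuclideanSpace ℝ (Fin (d + 1))))) (hκe k a b)
      (contDiffAt_id.prodMk contDiffAt_const)
  have hf : ∀ A : SphProd P d, ∏ k, κe k (embed A k) (B k) = prodKernel κ A B := fun A =>
    Finset.prod_congr rfl fun k _ => hκe_eq k (A k) (B k)
  have hs : ∀ A : SphProd P d, ContDiffAt ℝ 2 (fun w : Amb P d => ∏ k, κe k (w k) (B k))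
      (embed A) := fun A => contDiffAt_prod fun k _ =>
    ContDiffAt.comp (embed A) (f := fun w : Amb P d => w k) (hslice k (A k) (B k))
      (contDiff_block k).contDiffAt
  -- Positivity on the spheres extends to a neighbourhood by continuity, so the logarithms are
  -- genuine there.
  have hexp : (fun w : Amb P d => ∏ k, κe k (w k) (B k)) =ᶠ[nhds (embed A)]
      fun w => Real.exp (∑ k, Real.log (κe k (w k) (B k))) := by
    have h1 : ∀ᶠ w in nhds (embed A), ∀ k, 0 < κe k (w k) (B k) := by
      refine Filter.eventually_all.2 fun k => ?_
      have h2 : ∀ᶠ y in nhds (A k : EuclideanSpace ℝ (Fin (d + 1))), 0 < κe k y (B k) :=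
        continuousAt_const.eventually_lt (hslice k (A k) (B k)).continuousAt (hpos k (A k) (B k))
      exact ((contDiff_block k (n := 0)).continuous.continuousAt (x := embed A)).eventually h2
    filter_upwards [h1] with w hw
    rw [Real.exp_sum]
    exact Finset.prod_congr rfl fun k _ => (Real.exp_log (hw k)).symm
  have h := generator_exp_sum (fe := fun w : Amb P d => ∏ k, κe k (w k) (B k))
    (he := fun w => Real.log (pe w)) (h := fun C => Real.log (p C))
    (L := fun k y => Real.log (κe k y (B k)))
    (f := fun C => prodKernel κ C B) hf hs (fun A => by rw [hpe_eq]) A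
    ((hpe A).log (hpe_pos A).ne') (fun k => (hslice k (A k) (B k)).log (hpos k (A k) (B k)).ne')
    hexp
  rw [fhatIntegrand, h, embIntegrand, ← hf A]
  rfl

end SphereProduct

end

theorem mainTheorem8 (P d : ℕ)
    -- the sampling distribution `q` and the target density `p` on `(𝕊^{n-1})^P`, `n = d + 1`
    (q : Measure (SphProd P d)) [IsProbabilityMeasure q]
    (p : SphProd P d → ℝ) (hp : ∀ A, 0 < p A)
    -- the factors of the kernel
    (κ : Fin P → Sph d → Sph d → ℝ) (hκ : ∀ k a b, 0 < κ k a b)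
    -- the reproducing kernel Hilbert space of the product kernel
    {H : Type*} [NormedAddCommGroup H] [InnerProductSpace ℝ H] [CompleteSpace H]
    [RKHS ℝ H (SphProd P d) ℝ]
    (hH : ∀ A B, RKHS.kernel H A B 1 = prodKernel κ A B)
    -- `p` and the `κ k` are smooth: `pe` and `κe k` are expressions of them in the embedding
    -- space, smooth at the points of the manifold
    (pe : Amb P d → ℝ) (hpe : ∀ A, pe (embed A) = p A)
    (hpe_smooth : ∀ A : SphProd P d, ContDiffAt ℝ ∞ pe (embed A))
    (κe : Fin P → EuclideanSpace ℝ (Fin (d + 1)) → EuclideanSpace ℝ (Fin (d + 1)) → ℝ)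
    (hκe : ∀ k (a b : Sph d), κe k a b = κ k a b)
    (hκe_smooth : ∀ k (a b : Sph d), ContDiffAt ℝ ∞
      (fun w : EuclideanSpace ℝ (Fin (d + 1)) × EuclideanSpace ℝ (Fin (d + 1)) => κe k w.1 w.2)
      ((a : EuclideanSpace ℝ (Fin (d + 1))), (b : EuclideanSpace ℝ (Fin (d + 1))))) :
    -- `X̂ = grad f̂` is the functional gradient
    IsFunctionalGradient H q p (Xhat q p (prodKernel κ)) ∧
    -- `f̂` is given by the embedded expression, and all expectations exist
    (∀ B, Integrable (fhatIntegrand p (prodKernel κ) B) q ∧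
      Integrable (embIntegrand pe κe (embed B)) q ∧
      fhat q p (prodKernel κ) B = embFhat q pe κe (embed B)) ∧
    -- the blocks of `X̂`
    (∀ B, DifferentiableAt ℝ (embFhat q pe κe) (embed B) ∧
      ∀ ℓ, Xhat q p (prodKernel κ) B ℓ =
        tangentProj (B ℓ : EuclideanSpace ℝ (Fin (d + 1)))
          ((∇ (embFhat q pe κe) (embed B)) ℓ)) := by
  have hpe_pos : ∀ A : SphProd P d, 0 < pe (embed A) := fun A => by
    rw [hpe]
    exact hp A
  have hκe_pos : ∀ k (a b : Sph d), 0 < κe k a b := fun k a b => by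
    rw [hκe]
    exact hκ k a b
  have hpe2 : ∀ A : SphProd P d, ContDiffAt ℝ 2 pe (embed A) := fun A =>
    (hpe_smooth A).of_le two_le_infty
  have hΦ : ContDiffOn ℝ 2 (feature H) (nonzeroBlocks P d) :=
    contDiffOn_feature hH (contDiffOn_prodKernel_retract hκe hκe_smooth) 2
  obtain ⟨hgrad, hint⟩ := isFunctionalGradient_Xhat (q := q) (p := p)
    (he := fun w => Real.log (pe w)) hH hΦ (fun A => by rw [hpe])
    (fun A => ((hpe2 A).log (hpe_pos A).ne').of_le (by norm_num))
  have hpoint : ∀ B, fhatIntegrand p (prodKernel κ) B = embIntegrand pe κe (embed B) := fun B =>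
    funext fun A => fhatIntegrand_eq_embIntegrand hpe
      (fun A => (hpe2 A).differentiableAt (by norm_num)) hpe_pos hκe hκe_pos
      (fun k a b => (hκe_smooth k a b).of_le two_le_infty) B A
  have hfhat : ∀ B, embFhat q pe κe (embed B) = fhat q p (prodKernel κ) B := fun B => by
    rw [fhat, hpoint, embFhat]
  have hdiff : ∀ B, DifferentiableAt ℝ (embFhat q pe κe) (embed B) :=
    differentiableAt_embFhat hpe2 hpe_pos hκe_pos
      fun k a b => (hκe_smooth k a b).of_le three_le_infty
  refine ⟨hgrad, fun B => ⟨hint B, hpoint B ▸ hint B, (hfhat B).symm⟩, fun B => ⟨hdiff B, fun ℓ => ?_⟩⟩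
  -- `embFhat` is a differentiable extension of `f̂`, so its Euclidean gradient may be projected.
  rw [Xhat, grad_eq_tangentPart hfhat B (hdiff B), tangentProj_eq]
  rfl
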